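/- **Conventions.** For an ideal $\mathcal I$ of subsets of a set $X$, $\mathrm{add}(\mathcal I)$ is the least cardinality of a family $\mathcal F\subseteq\mathcal I$ with $\bigcup\mathcal F\notin\mathcal I$, and $\mathrm{non}(\mathcal I)$ is the least cardinality of a subset of $X$ that is not in $\mathcal I$. Let $\mathcal N$ and $\mathcal M$ be the ideals of Lebesgue null and of meager subsets of $\mathbb R$. Write $A\subseteq^* B$ if $A\setminus B$ is finite and $A=^*B$ if $A\,\triangle\, B$ is finite. For $S\subseteq\omega\times\omega$ let $S(n)=\{m:(n,m)\in S\}$. Let $\mathcal S$ be the set of all slaloms, i.e. of all $S\subseteq\omega\times\omega$ with $|S(n)|<2^n$ for every $n$, and let $\mathcal W$ be the set of all $S\in\mathcal S$ with $S(n)\subseteq\{0,\dots,2^n-1\}$ for every $n$ and $\sum_n |S(n)|/2^n<\infty$. Identify $k\in\omega$ with $\{0,\dots,k-1\}$, so that $n\times 2^n$ is a finite rectangle in $\omega\times\omega$. Let $\Omega$ be the (countable) set of all pairs $(S,n)$ with $n\in\omega$, $S\in\mathcal S$, $S\subseteq n\times 2^n$. Put $T_A=\{(T,n)\in\Omega: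 A\cap(n\times 2^n)\subseteq T\}$ for $A\subseteq\omega\times\omega$, and $T_{(S,n)}=\{(T,m)\in\Omega: m\ge n,\ T\cap(n\times 2^n)=S\}$ for $(S,n)\in\Omega$. For a family $\mathcal A$ of subsets of $\omega\times\omega$ let $\mathfrak T_{\mathcal A}$ be the subalgebra of $\mathcal P(\Omega)$ generated by $\{T_A:A\in\mathcal A\}\cup\{T_{(S,n)}:(S,n)\in\Omega\}$, and let $K_{\mathcal A}$ be the Stone space of $\mathfrak T_{\mathcal A}/\mathrm{Fin}$ (the image of $\mathfrak T_{\mathcal A}$ in $\mathcal P(\Omega)/\mathrm{Fin}$). A growth of $\omega$ is a space $L\setminus\omega$, where $L$ is a compact Hausdorff space containing the discrete space $\omega$ as a dense subspace. A space supports a measure if it carries a finite Radon measure that is positive on every nonempty open set. It has countable $\pi$-character if for every point $x$ there is a countable family of nonempty open sets such that every neighbourhood of $x$ contains a member of the family. It is scatteredly-fibered (linearly-fibered) if it has a continuous map into a metric space all of whose fibers are scattered, i.e. every nonempty subset of a fiber has a relatively isolated point (respectively, all of whose fibers carry the order topology of some linear order). **Theorem.** Assume $\mathrm{add}(\mathcal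 N)=\mathrm{non}(\mathcal M)$ and put $\kappa=\mathrm{add}(\mathcal N)$. Then there is a family $(A_\alpha)_{\alpha<\kappa}$ of elements of $\mathcal W$ such that $A_\alpha\subseteq^* A_\beta$ whenever $\alpha<\beta<\kappa$, and such that for every $S\in\mathcal S$ there is $\alpha<\kappa$ with $A_\alpha\not\subseteq^* S$. Moreover, for every such family, if $\mathcal A=\{A\in\mathcal S: A=^*A_\alpha\text{ for some }\alpha<\kappa\}$, then the space $K_{\mathcal A}$ is homeomorphic to a growth of $\omega$, is not separable, supports a measure, has countable $\pi$-character, is scatteredly-fibered and is linearly-fibered; in particular, it does not map continuously onto $[0,1]^{\omega_1}$. -/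

import Mathlib

open Set Topology MeasureTheory

/-! ### Cardinal invariants of ideals -/

/-- `add(I)`: the least size of a subfamily of `I` whose union is not in `I`. -/
noncomputable def idealAdd {X : Type} (I : Set (Set X)) : Cardinal.{0} :=
  sInf {κ | ∃ F : Set (Set X), F ⊆ I ∧ ⋃₀ F ∉ I ∧ Cardinal.mk F = κ}

/-- `non(I)`: the least size of a set that is not in `I`. -/
noncomputable def idealNon {X : Type} (I : Set (Set X)) : Cardinal.{0} :=
  sInf {κ | ∃ s : Set X, s ∉ I ∧ Cardinal.mk s = κ}

/-- The ideal of Lebesgue null sets of reals. -/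
def nullIdeal : Set (Set ℝ) := {s | volume s = 0}

/-- The ideal of meager sets of reals. -/
def meagerIdeal : Set (Set ℝ) := {s | IsMeagre s}

/-! ### The Boolean algebra of subsets of `X` modulo finite sets -/

/-- Equality up to a finite set. -/
def modFinSetoid (X : Type*) : Setoid (Set X) where
  r s t := (symmDiff s t).Finite
  iseqv :=
    { refl := fun s => by simp
      symm := fun {s t} h => by rwa [symmDiff_comm]
      trans := fun {s t u} h₁ h₂ =>
        (h₁.union h₂).subset (symmDiff_triangle s t u) }

/-- The algebra `𝒫(X)/Fin`. -/
def ModFin (X : Type*) : Type _ := Quotient (modFinSetoid X)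

namespace ModFin

variable {X : Type*}

/-- The class of a set modulo finite sets. -/
def mk (s : Set X) : ModFin X := Quotient.mk (modFinSetoid X) s

theorem mk_eq_mk {s t : Set X} : mk s = mk t ↔ (symmDiff s t).Finite :=
  ⟨fun h => Quotient.exact h, fun h => Quotient.sound h⟩

theorem finite_diff_congr {s s' t t' : Set X} (hs : (symmDiff s s').Finite)
    (ht : (symmDiff t t').Finite) (h : (s \ t).Finite) : (s' \ t').Finite :=
  ((hs.union ht).union h).subset fun x hx => by
    simp only [mem_union, mem_symmDiff, mem_sdiff] at *
    tauto

instance : LE (ModFin X) where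
  le := Quotient.lift₂ (fun s t : Set X => (s \ t).Finite) fun s t s' t' hs ht =>
    propext ⟨finite_diff_congr hs ht,
      finite_diff_congr (by rwa [symmDiff_comm]) (by rwa [symmDiff_comm])⟩

instance : Max (ModFin X) where
  max := Quotient.map₂ (fun s t : Set X => s ∪ t) fun s s' hs t t' ht =>
    (hs.union ht).subset fun x hx => by
      simp only [mem_union, mem_symmDiff] at *
      tauto

instance : Min (ModFin X) where
  min := Quotient.map₂ (fun s t : Set X => s ∩ t) fun s s' hs t t' ht =>
    (hs.union ht).subset fun x hx => by
      simp only [mem_union, mem_inter_iff, mem_symmDiff] at *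
      tauto

instance : Compl (ModFin X) where
  compl := Quotient.map (fun s : Set X => sᶜ) fun s s' hs =>
    hs.subset fun x hx => by
      simp only [mem_compl_iff, mem_symmDiff] at *
      tauto

instance : Top (ModFin X) := ⟨mk univ⟩

instance : Bot (ModFin X) := ⟨mk ∅⟩

theorem mk_le_mk {s t : Set X} : mk s ≤ mk t ↔ (s \ t).Finite := Iff.rfl

theorem ind {p : ModFin X → Prop} (h : ∀ s, p (mk s)) (a : ModFin X) : p a :=
  Quotient.ind h a

theorem mk_le_mk_of_subset {s t : Set X} (h : s ⊆ t) : mk s ≤ mk t := by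
  rw [mk_le_mk, sdiff_eq_empty.2 h]
  exact finite_empty

instance : BooleanAlgebra (ModFin X) where
  le_refl a := by
    induction a using ind with | _ s
    exact mk_le_mk_of_subset (subset_refl s)
  le_trans a b c := by
    induction a using ind with | _ s
    induction b using ind with | _ t
    induction c using ind with | _ u
    intro h₁ h₂
    refine ((mk_le_mk.1 h₁).union (mk_le_mk.1 h₂)).subset fun x hx => ?_
    simp only [mem_union, mem_sdiff] at *
    tauto
  le_antisymm a b := by
    induction a using ind with | _ s
    induction b using ind with | _ t
    intro h₁ h₂
    exact mk_eq_mk.2 ((mk_le_mk.1 h₁).union (mk_le_mk.1 h₂))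
  sup := max
  inf := min
  le_sup_left a b := by
    induction a using ind with | _ s
    induction b using ind with | _ t
    exact mk_le_mk_of_subset (t := s ∪ t) subset_union_left
  le_sup_right a b := by
    induction a using ind with | _ s
    induction b using ind with | _ t
    exact mk_le_mk_of_subset (t := s ∪ t) subset_union_right
  sup_le a b c := by
    induction a using ind with | _ s
    induction b using ind with | _ t
    induction c using ind with | _ u
    intro h₁ h₂
    refine ((mk_le_mk.1 h₁).union (mk_le_mk.1 h₂)).subset fun x hx => ?_
    simp only [mem_union, mem_sdiff] at *
    tauto
  inf_le_left a b := by
    induction a using ind with | _ s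
    induction b using ind with | _ t
    exact mk_le_mk_of_subset (s := s ∩ t) inter_subset_left
  inf_le_right a b := by
    induction a using ind with | _ s
    induction b using ind with | _ t
    exact mk_le_mk_of_subset (s := s ∩ t) inter_subset_right
  le_inf a b c := by
    induction a using ind with | _ s
    induction b using ind with | _ t
    induction c using ind with | _ u
    intro h₁ h₂
    refine ((mk_le_mk.1 h₁).union (mk_le_mk.1 h₂)).subset fun x hx => ?_
    simp only [mem_union, mem_inter_iff, mem_sdiff] at *
    tauto
  le_sup_inf a b c := by
    induction a using ind with | _ s
    induction b using ind with | _ t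
    induction c using ind with | _ u
    refine mk_le_mk_of_subset (s := (s ∪ t) ∩ (s ∪ u)) (t := s ∪ (t ∩ u)) fun x hx => ?_
    simp only [mem_union, mem_inter_iff] at *
    tauto
  inf_compl_le_bot a := by
    induction a using ind with | _ s
    exact mk_le_mk_of_subset (s := s ∩ sᶜ) (t := ∅) (by simp)
  top_le_sup_compl a := by
    induction a using ind with | _ s
    exact mk_le_mk_of_subset (s := univ) (t := s ∪ sᶜ) (by simp)
  le_top a := by
    induction a using ind with | _ s
    exact mk_le_mk_of_subset (t := univ) (subset_univ s)
  bot_le a := by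
    induction a using ind with | _ s
    exact mk_le_mk_of_subset (s := ∅) (empty_subset s)

/-- The quotient homomorphism `𝒫(X) → 𝒫(X)/Fin`. -/
def mkHom (X : Type*) : BoundedLatticeHom (Set X) (ModFin X) where
  toFun := mk
  map_sup' _ _ := rfl
  map_inf' _ _ := rfl
  map_top' := by rfl
  map_bot' := by rfl

end ModFin

/-! ### Stone spaces -/

/-- `U` is an ultrafilter of the Boolean algebra `B`. -/
structure IsUltrafilterOf {B : Type*} [BooleanAlgebra B] (U : Set B) : Prop where
  top_mem : ⊤ ∈ U
  bot_notMem : ⊥ ∉ U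
  inf_mem : ∀ a ∈ U, ∀ b ∈ U, a ⊓ b ∈ U
  mem_of_le : ∀ a ∈ U, ∀ b, a ≤ b → b ∈ U
  mem_or_compl_mem : ∀ a, a ∈ U ∨ aᶜ ∈ U

/-- The Stone space of `B`: all ultrafilters of `B`. -/
def StoneSpace (B : Type*) [BooleanAlgebra B] : Type _ := {U : Set B // IsUltrafilterOf U}

/-- The Stone topology, with the sets `{U | a ∈ U}` as a base. -/
instance (B : Type*) [BooleanAlgebra B] : TopologicalSpace (StoneSpace B) :=
  TopologicalSpace.generateFrom (range fun a : B => {U : StoneSpace B | a ∈ U.1})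

/-! ### Topological properties -/

/-- `K` is homeomorphic to a growth of `ω`, i.e. to the remainder `L \ ω` of some Hausdorff
compactification `L` of the countable infinite discrete space. -/
def IsGrowthOfOmega (K : Type) [TopologicalSpace K] : Prop :=
  ∃ (L : Type) (_ : TopologicalSpace L) (_ : CompactSpace L) (_ : T2Space L) (e : ℕ → L),
    IsEmbedding e ∧ DenseRange e ∧ Nonempty (K ≃ₜ ((range e)ᶜ : Set L))

/-- `K` carries a finite Radon measure which is positive on all nonempty open sets. -/
def SupportsMeasure (K : Type*) [TopologicalSpace K] : Prop :=
  ∃ μ : @Measure K (borel K), @IsFiniteMeasure K (borel K) μ ∧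
    @Measure.Regular K (borel K) _ μ ∧ ∀ U : Set K, IsOpen U → U.Nonempty → 0 < μ U

/-- Every point of `K` has a countable local `π`-base. -/
def HasCountablePiCharacter (K : Type*) [TopologicalSpace K] : Prop :=
  ∀ x : K, ∃ P : Set (Set K), P.Countable ∧ (∀ V ∈ P, IsOpen V ∧ V.Nonempty) ∧
    ∀ U ∈ 𝓝 x, ∃ V ∈ P, V ⊆ U

/-- Every nonempty subset of `F` has a relatively isolated point. -/
def IsScatteredSpace (F : Type*) [TopologicalSpace F] : Prop :=
  ∀ s : Set F, s.Nonempty → ∃ x ∈ s, ∃ U : Set F, IsOpen U ∧ U ∩ s = {x}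

/-- The topology of `F` is the order topology of some linear order. -/
def IsLinearlyOrderedSpace (F : Type*) [TopologicalSpace F] : Prop :=
  ∃ _ : LinearOrder F, OrderTopology F

/-- There is a continuous map to a metric space all of whose fibers are scattered. -/
def IsScatteredlyFibered (K : Type) [TopologicalSpace K] : Prop :=
  ∃ (M : Type) (_ : MetricSpace M) (f : K → M), Continuous f ∧
    ∀ y : M, IsScatteredSpace (f ⁻¹' {y})

/-- There is a continuous map to a metric space all of whose fibers are linearly ordered spaces. -/
def IsLinearlyFibered (K : Type) [TopologicalSpace K] : Prop :=
  ∃ (M : Type) (_ : MetricSpace M) (f : K → M), Continuous f ∧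
    ∀ y : M, IsLinearlyOrderedSpace (f ⁻¹' {y})

/-- `K` maps continuously onto the Tychonoff cube `[0,1]^{ω₁}`. -/
def MapsOntoCubeOmegaOne (K : Type*) [TopologicalSpace K] : Prop :=
  ∃ g : K → ((Ordinal.omega.{0} 1).ToType → unitInterval), Continuous g ∧ Function.Surjective g

/-! ### Slaloms and the spaces `K_𝒜` -/

namespace Slalom

/-- `S(n) = {m | (n, m) ∈ S}`. -/
def sec (S : Set (ℕ × ℕ)) (n : ℕ) : Set ℕ := {m | (n, m) ∈ S}

/-- `S ∈ 𝒮`: every section `S(n)` has fewer than `2 ^ n` elements. -/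
def IsSlalom (S : Set (ℕ × ℕ)) : Prop := ∀ n, (sec S n).encard < ((2 ^ n : ℕ) : ℕ∞)

/-- `S ∈ 𝒲`: a slalom with `S(n) ⊆ {0, …, 2 ^ n - 1}` for all `n` and `∑ |S(n)| / 2 ^ n < ∞`. -/
def IsSummableSlalom (S : Set (ℕ × ℕ)) : Prop :=
  IsSlalom S ∧ (∀ n, sec S n ⊆ Iio (2 ^ n)) ∧
    Summable fun n => ((sec S n).ncard : ℝ) / 2 ^ n

/-- `A ⊆* B`. -/
def AlmostSubset (A B : Set (ℕ × ℕ)) : Prop := (A \ B).Finite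

/-- `A =* B`. -/
def AlmostEq (A B : Set (ℕ × ℕ)) : Prop := (symmDiff A B).Finite

/-- The rectangle `n × 2 ^ n = {0, …, n - 1} × {0, …, 2 ^ n - 1}`. -/
def box (n : ℕ) : Set (ℕ × ℕ) := Iio n ×ˢ Iio (2 ^ n)

/-- The countable set `Ω` of all pairs `(S, n)` with `S` a slalom contained in `n × 2 ^ n`. -/
def Node : Type := {p : Set (ℕ × ℕ) × ℕ // IsSlalom p.1 ∧ p.1 ⊆ box p.2}

/-- `T_A = {(T, n) ∈ Ω | A ∩ (n × 2 ^ n) ⊆ T}`. -/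
def above (A : Set (ℕ × ℕ)) : Set Node := {q | A ∩ box q.1.2 ⊆ q.1.1}

/-- `T_(S, n) = {(T, m) ∈ Ω | m ≥ n, T ∩ (n × 2 ^ n) = S}`. -/
def cone (p : Node) : Set Node := {q | p.1.2 ≤ q.1.2 ∧ q.1.1 ∩ box p.1.2 = p.1.1}

/-- The subalgebra `𝔗_𝒜` of `𝒫(Ω)` generated by all `T_A` with `A ∈ 𝒜` and all `T_(S, n)`. -/
def treeAlg (𝒜 : Set (Set (ℕ × ℕ))) : BooleanSubalgebra (Set Node) :=
  BooleanSubalgebra.closure (above '' 𝒜 ∪ range cone)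

/-- The Boolean algebra `𝔗_𝒜 / Fin`, as a subalgebra of `𝒫(Ω)/Fin`. -/
def treeAlgModFin (𝒜 : Set (Set (ℕ × ℕ))) : BooleanSubalgebra (ModFin Node) :=
  (treeAlg 𝒜).map (ModFin.mkHom Node)

/-- The space `K_𝒜`: the Stone space of `𝔗_𝒜 / Fin`. -/
abbrev KSpace (𝒜 : Set (Set (ℕ × ℕ))) : Type := StoneSpace (treeAlgModFin 𝒜)

/-- `(A_α)_{α < κ}` is a `⊆*`-increasing chain in `𝒲` that no slalom bounds. -/
structure IsUnboundedChain (κ : Cardinal.{0}) (A : Set.Iio κ.ord → Set (ℕ × ℕ)) : Prop where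
  mem : ∀ α, IsSummableSlalom (A α)
  mono : ∀ α β, α < β → AlmostSubset (A α) (A β)
  unbounded : ∀ S, IsSlalom S → ∃ α, ¬ AlmostSubset (A α) S

/-- The closure of a family under finite modifications inside `𝒮`. -/
def finiteModClosure {ι : Type*} (A : ι → Set (ℕ × ℕ)) : Set (Set (ℕ × ℕ)) :=
  {B | IsSlalom B ∧ ∃ i, AlmostEq B (A i)}

end Slalom

/-! ### Stone spaces of Boolean algebras -/

namespace IsUltrafilterOf

variable {B : Type*} [BooleanAlgebra B] {U : Set B}

/-! A point of the space is the trace on the algebra of a nonprincipal ultrafilter `u` on the nodes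
(`exists_stonePoint_eq`). Such a `u` determines a slalom `B`, its branch, and the set of those `E`
in the family with `above E ∈ u`. All these `E` are contained in `B`. Branch and trace determine the
point (`ext_of_branchOf_traceOf`). The family is linearly preordered by `⊆*`, and `above E' ∈ u`, `E
⊆* E'`, `E ⊆ B` imply `above E ∈ u` (`above_mem_of_almostSubset`). So over a fixed branch the traces
are linearly ordered by inclusion, and the well-order of the index set makes the fibers of the
branch map scattered. Since the branch map goes into a Cantor cube, a surjection onto `[0,1]^{ω₁}`
would send one of its fibers onto `[0,1]` by a coordinate, which a compact scattered space does not
allow.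

Unboundedness of the tower gives, for each branch `B`, a `δ` such that every `E ⊆ B` in the family
is `⊆* A δ`. Hence the countably many sets `cone q ∩ above (q ∪ tail (A δ))` form a local π-base
(`exists_piBase`). For the measure, remove from the full rectangle one random point at each level
beyond a node: a set whose tail has weight below `1` is missed with positive probability, so every
member of the π-base gets positive mass. Nonseparability holds because countably many branches fail
to bound countably many `A δ`, these have a common bound in `𝒲`, and a later `A α` lies in none of
the branches.

Towers exist because fewer than `add(𝒩)` members of `𝒲` have a common `⊆*`-bound in `𝒲`
(`exists_isSummableSlalom_of_lt`), while the reals `t` whose `digitGraph t` is almost covered by one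
slalom form a meager set. A recursion along a nonmeager set of size `non(ℳ) = add(𝒩)` swallows all
its digit graphs. -/

theorem compl_mem_iff (hU : IsUltrafilterOf U) {a : B} : aᶜ ∈ U ↔ a ∉ U := by
  refine ⟨fun h h' => hU.bot_notMem ?_, fun h => (hU.mem_or_compl_mem a).resolve_left h⟩
  simpa using hU.inf_mem _ h' _ h

theorem inf_mem_iff (hU : IsUltrafilterOf U) {a b : B} : a ⊓ b ∈ U ↔ a ∈ U ∧ b ∈ U :=
  ⟨fun h => ⟨hU.mem_of_le _ h _ inf_le_left, hU.mem_of_le _ h _ inf_le_right⟩,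
    fun h => hU.inf_mem _ h.1 _ h.2⟩

theorem sup_mem_iff (hU : IsUltrafilterOf U) {a b : B} : a ⊔ b ∈ U ↔ a ∈ U ∨ b ∈ U := by
  have := hU.inf_mem_iff (a := aᶜ) (b := bᶜ)
  rw [← compl_sup, hU.compl_mem_iff, hU.compl_mem_iff, hU.compl_mem_iff] at this
  tauto

theorem eq_of_subset {V : Set B} (hU : IsUltrafilterOf U) (hV : IsUltrafilterOf V) (h : U ⊆ V) :
    U = V :=
  h.antisymm fun _ ha => by_contra fun h' => hV.compl_mem_iff.1 (h (hU.compl_mem_iff.2 h')) ha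

end IsUltrafilterOf

namespace StoneSpace

variable {B : Type*} [BooleanAlgebra B]

/-- The basic open set of all ultrafilters containing `a`. -/
def basic (a : B) : Set (StoneSpace B) := {U | a ∈ U.1}

@[simp] theorem mem_basic {a : B} {U : StoneSpace B} : U ∈ basic a ↔ a ∈ U.1 := Iff.rfl

theorem isOpen_basic (a : B) : IsOpen (basic a) :=
  TopologicalSpace.isOpen_generateFrom_of_mem (mem_range_self a)

theorem basic_compl (a : B) : basic aᶜ = (basic a)ᶜ :=
  ext fun U => U.2.compl_mem_iff

theorem basic_sup (a b : B) : basic (a ⊔ b) = basic a ∪ basic b :=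
  ext fun U => U.2.sup_mem_iff

theorem basic_bot : basic (⊥ : B) = ∅ :=
  eq_empty_of_forall_notMem fun U => U.2.bot_notMem

theorem isClopen_basic (a : B) : IsClopen (basic a) :=
  ⟨⟨by rw [← basic_compl]; exact isOpen_basic _⟩, isOpen_basic a⟩

theorem isTopologicalBasis_basic :
    TopologicalSpace.IsTopologicalBasis (range (basic : B → Set (StoneSpace B))) where
  exists_subset_inter := by
    rintro _ ⟨a, rfl⟩ _ ⟨b, rfl⟩ U hU
    exact ⟨_, ⟨a ⊓ b, rfl⟩, U.2.inf_mem_iff.2 hU, fun V hV => V.2.inf_mem_iff.1 hV⟩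
  sUnion_eq := eq_univ_of_forall fun U => ⟨_, ⟨⊤, rfl⟩, U.2.top_mem⟩
  eq_generateFrom := rfl

theorem exists_basic_subset {s : Set (StoneSpace B)} {U : StoneSpace B} (hs : s ∈ 𝓝 U) :
    ∃ a ∈ U.1, basic a ⊆ s := by
  obtain ⟨_, ⟨a, rfl⟩, ha, h⟩ := isTopologicalBasis_basic.mem_nhds_iff.1 hs
  exact ⟨a, ha, h⟩

instance : T2Space (StoneSpace B) where
  t2 U V hne := by
    obtain ⟨a, haU, haV⟩ : ∃ a ∈ U.1, a ∉ V.1 := by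
      by_contra! h
      exact hne (Subtype.ext (U.2.eq_of_subset V.2 h))
    refine ⟨basic a, basic aᶜ, isOpen_basic _, isOpen_basic _, haU, V.2.compl_mem_iff.2 haV, ?_⟩
    rw [basic_compl]
    exact disjoint_compl_right

instance : CompactSpace (StoneSpace B) where
  isCompact_univ := by
    refine isCompact_iff_ultrafilter_le_nhds.2 fun F _ => ?_
    have hV : IsUltrafilterOf {a : B | basic a ∈ F} :=
      { top_mem := Filter.mem_of_superset Filter.univ_mem fun U _ => U.2.top_mem
        bot_notMem := by simp [basic_bot]
        inf_mem := fun a ha b hb =>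
          Filter.mem_of_superset (Filter.inter_mem ha hb) fun U hU => U.2.inf_mem_iff.2 hU
        mem_of_le := fun a ha b hab =>
          Filter.mem_of_superset ha fun U hU => U.2.mem_of_le _ hU _ hab
        mem_or_compl_mem := fun a => by
          simp only [mem_ofPred_eq, basic_compl]
          exact F.mem_or_compl_mem _ }
    let V : StoneSpace B := ⟨_, hV⟩
    refine ⟨V, mem_univ _, ?_⟩
    rw [TopologicalSpace.nhds_generateFrom]
    refine le_iInf₂ fun s hs => ?_
    obtain ⟨h, a, rfl⟩ := hs
    exact Filter.le_principal_iff.2 h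

theorem exists_basic_between {s V : Set (StoneSpace B)} (hs : IsCompact s) (hV : IsOpen V)
    (h : s ⊆ V) : ∃ a : B, s ⊆ basic a ∧ basic a ⊆ V := by
  refine hs.induction_on (p := fun t => ∃ a : B, t ⊆ basic a ∧ basic a ⊆ V)
    ⟨⊥, empty_subset _, by simp [basic_bot]⟩ (fun t u htu ⟨a, ha⟩ => ⟨a, htu.trans ha.1, ha.2⟩)
    ?_ fun x hx => ?_
  · rintro t u ⟨a, ha, ha'⟩ ⟨b, hb, hb'⟩
    refine ⟨a ⊔ b, ?_, ?_⟩ <;> rw [basic_sup]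
    exacts [union_subset_union ha hb, union_subset ha' hb']
  · obtain ⟨a, ha, haV⟩ := exists_basic_subset (hV.mem_nhds (h hx))
    exact ⟨basic a, mem_nhdsWithin_of_mem_nhds ((isOpen_basic a).mem_nhds ha), a, Subset.rfl, haV⟩

/-- A continuous function on a Stone space pulls back to a measurable function along every map
that pulls back the basic open sets to measurable sets. -/
theorem measurable_comp {Y : Type*} [MeasurableSpace Y] {g : Y → StoneSpace B}
    (hg : ∀ a, MeasurableSet (g ⁻¹' basic a)) {φ : StoneSpace B → ℝ} (hφ : Continuous φ) :
    Measurable fun y => φ (g y) := by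
  refine measurable_of_Ioi fun c => ?_
  -- By compactness a basic set fits between `{φ ≥ c + 1/(n+1)}` and `{φ > c}`, so the latter is a
  -- countable union of basic sets. General open sets need not pull back to measurable sets.
  have key : ∀ n : ℕ, ∃ a : B, φ ⁻¹' Ici (c + 1 / (n + 1)) ⊆ basic a ∧ basic a ⊆ φ ⁻¹' Ioi c :=
    fun n => exists_basic_between (isClosed_Ici.preimage hφ).isCompact (isOpen_Ioi.preimage hφ)
      (preimage_mono (Ici_subset_Ioi.2 (lt_add_of_pos_right c Nat.one_div_pos_of_nat)))
  choose a ha ha' using key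
  have : (fun y => φ (g y)) ⁻¹' Ioi c = ⋃ n, g ⁻¹' basic (a n) := by
    refine Subset.antisymm (fun y hy => ?_) (iUnion_subset fun n y hy => ha' n hy)
    obtain ⟨n, hn⟩ := exists_nat_one_div_lt (sub_pos.2 (show c < φ (g y) from hy))
    exact mem_iUnion.2 ⟨n, ha n (show c + 1 / (n + 1) ≤ φ (g y) by linarith)⟩
  rw [this]
  exact .iUnion fun n => hg _

/-- A finite measure on `Y` which gives positive measure to the pullbacks of all nonempty basic
open sets yields a strictly positive Radon measure. -/
theorem supportsMeasure {Y : Type*} [MeasurableSpace Y] (ρ : Measure Y) [IsFiniteMeasure ρ]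
    {g : Y → StoneSpace B} (hg : ∀ a, MeasurableSet (g ⁻¹' basic a))
    (hpos : ∀ a : B, (basic a).Nonempty → 0 < ρ (g ⁻¹' basic a)) :
    SupportsMeasure (StoneSpace B) := by
  let _ : MeasurableSpace (StoneSpace B) := borel _
  have _ : BorelSpace (StoneSpace B) := ⟨rfl⟩
  have hint : ∀ φ : CompactlySupportedContinuousMap (StoneSpace B) ℝ,
      Integrable (fun y => φ (g y)) ρ := fun φ => by
    obtain ⟨C, hC⟩ := (isCompact_range φ.continuous).isBounded.exists_norm_le
    exact .of_bound (measurable_comp hg φ.continuous).aestronglyMeasurable C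
      (.of_forall fun y => hC _ (mem_range_self _))
  -- As `g` need not be Borel measurable, `ρ` is not pushed forward directly; integration along `g`
  -- is a positive functional, to which the Riesz–Markov–Kakutani theorem applies.
  let Λ : CompactlySupportedContinuousMap (StoneSpace B) ℝ →ₚ[ℝ] ℝ :=
    { toFun := fun φ => ∫ y, φ (g y) ∂ρ
      map_add' := fun φ ψ => integral_add (hint φ) (hint ψ)
      map_smul' := fun c φ => integral_smul c fun y => φ (g y)
      monotone' := fun φ ψ h => integral_mono (hint φ) (hint ψ) fun y => h (g y) }
  refine ⟨RealRMK.rieszMeasure Λ, inferInstance, inferInstance, fun U hU ⟨x, hx⟩ => ?_⟩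
  obtain ⟨a, ha, haU⟩ := exists_basic_subset (hU.mem_nhds hx)
  refine lt_of_lt_of_le ?_ (measure_mono haU)
  let φ : CompactlySupportedContinuousMap (StoneSpace B) ℝ :=
    { toFun := (basic a).indicator fun _ => 1
      continuous_toFun := continuous_const.indicator fun y hy => by
        simp [(isClopen_basic a).frontier_eq] at hy
      hasCompactSupport' := HasCompactSupport.of_compactSpace _ }
  have h1 : ∫ y, φ y ∂(RealRMK.rieszMeasure Λ) = (RealRMK.rieszMeasure Λ).real (basic a) := by
    simp [φ, integral_indicator (isOpen_basic a).measurableSet]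
  have h2 : Λ φ = ρ.real (g ⁻¹' basic a) := by
    change ∫ y, (basic a).indicator (fun _ => (1 : ℝ)) (g y) ∂ρ = _
    rw [← integral_indicator_one (hg a)]
    rfl
  rw [RealRMK.integral_rieszMeasure, h2] at h1
  by_contra! h0
  have h3 : ρ.real (g ⁻¹' basic a) = 0 := by rw [h1, measureReal_def, le_antisymm h0 bot_le]; simp
  exact (hpos a ⟨x, ha⟩).ne' ((measureReal_eq_zero_iff).1 h3)

end StoneSpace

/-! ### Stone spaces of algebras of sets modulo finite sets -/

namespace BooleanSubalgebra

variable {X : Type*} (T : BooleanSubalgebra (Set X))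

/-- The image of an algebra of sets in the algebra of sets modulo finite sets. -/
abbrev modFin : BooleanSubalgebra (ModFin X) := T.map (ModFin.mkHom X)

variable {T}

/-- The class modulo finite sets of a member of the algebra. -/
def toModFin {a : Set X} (ha : a ∈ T) : T.modFin := ⟨ModFin.mk a, a, ha, rfl⟩

theorem exists_eq_toModFin (b : T.modFin) : ∃ (a : Set X) (ha : a ∈ T), b = toModFin ha := by
  obtain ⟨_, a, ha, rfl⟩ := b
  exact ⟨a, ha, rfl⟩

theorem toModFin_le {a b : Set X} (ha : a ∈ T) (hb : b ∈ T) :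
    toModFin ha ≤ toModFin hb ↔ (a \ b).Finite := Iff.rfl

variable (T) in
/-- The trace of a nonprincipal ultrafilter on `X`. -/
def stonePoint (u : Ultrafilter X) (hu : (u : Filter X) ≤ Filter.cofinite) :
    StoneSpace T.modFin :=
  ⟨{b | ∃ (a : Set X) (ha : a ∈ T), a ∈ u ∧ b = toModFin ha},
    { top_mem := ⟨univ, T.top_mem, Filter.univ_mem, rfl⟩
      bot_notMem := by
        rintro ⟨a, ha, hau, h⟩
        have hfin : a.Finite := by
          have h' := (toModFin_le ha T.bot_mem).1 h.ge
          rwa [show a \ (⊥ : Set X) = a from sdiff_bot] at h'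
        exact u.compl_notMem_iff.2 hau (hu hfin.compl_mem_cofinite)
      inf_mem := by
        rintro _ ⟨a, ha, hau, rfl⟩ _ ⟨b, hb, hbu, rfl⟩
        exact ⟨a ∩ b, T.inf_mem ha hb, Filter.inter_mem hau hbu, rfl⟩
      mem_of_le := by
        rintro _ ⟨a, ha, hau, rfl⟩ b hab
        obtain ⟨b, hb, rfl⟩ := exists_eq_toModFin b
        refine ⟨b, hb, ?_, rfl⟩
        have h : (a \ b)ᶜ ∈ u := hu ((toModFin_le ha hb).1 hab).compl_mem_cofinite
        exact Filter.mem_of_superset (Filter.inter_mem hau h) fun x hx => by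
          simp only [mem_inter_iff, mem_compl_iff, mem_sdiff] at hx
          tauto
      mem_or_compl_mem := fun b => by
        obtain ⟨b, hb, rfl⟩ := exists_eq_toModFin b
        rcases u.mem_or_compl_mem b with h | h
        · exact .inl ⟨b, hb, h, rfl⟩
        · exact .inr ⟨bᶜ, T.compl_mem hb, h, rfl⟩ }⟩

theorem toModFin_mem_stonePoint {u : Ultrafilter X} (hu : (u : Filter X) ≤ Filter.cofinite)
    {a : Set X} (ha : a ∈ T) : toModFin ha ∈ (stonePoint T u hu).1 ↔ a ∈ u := by
  refine ⟨?_, fun h => ⟨a, ha, h, rfl⟩⟩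
  rintro ⟨b, hb, hbu, h⟩
  have h : (b \ a)ᶜ ∈ u := hu ((toModFin_le hb ha).1 h.ge).compl_mem_cofinite
  exact Filter.mem_of_superset (Filter.inter_mem hbu h) fun x hx => by
    simp only [mem_inter_iff, mem_compl_iff, mem_sdiff] at hx
    tauto

/-- The representatives of the members of `x` generate a proper filter on `X` that contains all
cofinite sets. Any ultrafilter refining it works, since ultrafilters of an algebra are maximal. -/
theorem exists_stonePoint_eq (x : StoneSpace T.modFin) :
    ∃ (u : Ultrafilter X) (hu : (u : Filter X) ≤ Filter.cofinite), stonePoint T u hu = x := by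
  let F : Filter X :=
    { sets := {s | ∃ (a : Set X) (ha : a ∈ T), toModFin ha ∈ x.1 ∧ (a \ s).Finite}
      univ_sets := ⟨univ, T.top_mem, x.2.top_mem, by simp⟩
      sets_of_superset := by
        rintro s t ⟨a, ha, hax, has⟩ hst
        exact ⟨a, ha, hax, has.subset (sdiff_subset_sdiff_right hst)⟩
      inter_sets := by
        rintro s t ⟨a, ha, hax, has⟩ ⟨b, hb, hbx, hbt⟩
        refine ⟨a ∩ b, T.inf_mem ha hb, x.2.inf_mem _ hax _ hbx, (has.union hbt).subset ?_⟩
        intro y hy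
        simp only [mem_union, mem_inter_iff, mem_sdiff] at *
        tauto }
  have hne : F.NeBot := ⟨fun h => by
    obtain ⟨a, ha, hax, hfin⟩ : (∅ : Set X) ∈ F := by rw [h]; trivial
    refine x.2.bot_notMem (x.2.mem_of_le _ hax _ ?_)
    exact (toModFin_le ha T.bot_mem).2 hfin⟩
  have hle : (Ultrafilter.of F : Filter X) ≤ Filter.cofinite :=
    (Ultrafilter.of_le F).trans fun s hs =>
      ⟨univ, T.top_mem, x.2.top_mem, by simpa [← compl_eq_univ_sdiff] using hs⟩
  refine ⟨Ultrafilter.of F, hle, Subtype.ext (Eq.symm ?_)⟩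
  refine x.2.eq_of_subset (stonePoint T _ hle).2 fun b hb => ?_
  obtain ⟨a, ha, rfl⟩ := exists_eq_toModFin b
  exact ⟨a, ha, Ultrafilter.of_le F ⟨a, ha, hb, by simp⟩, rfl⟩

end BooleanSubalgebra

/-! ### The remainder of the compactification given by an algebra of sets -/

namespace BooleanSubalgebra

variable {X : Type*} {T : BooleanSubalgebra (Set X)}

theorem mem_of_finite (hT : ∀ q : X, {q} ∈ T) {a : Set X} (ha : a.Finite) : a ∈ T := by
  induction a, ha using Set.Finite.induction_on with
  | empty => exact T.bot_mem
  | @insert q s _ _ ih => exact T.sup_mem (hT q) ih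

variable (T) in
/-- The principal ultrafilter at `q`. -/
def principalPoint (q : X) : StoneSpace T :=
  ⟨{a | q ∈ a.1},
    { top_mem := mem_univ q
      bot_notMem := fun h => h
      inf_mem := fun _ ha _ hb => ⟨ha, hb⟩
      mem_of_le := fun _ ha _ hab => hab ha
      mem_or_compl_mem := fun a => em (q ∈ a.1) }⟩

variable (T) in
/-- The map of Stone spaces induced by the quotient map modulo finite sets. -/
def liftPoint (x : StoneSpace T.modFin) : StoneSpace T :=
  ⟨{a | toModFin a.2 ∈ x.1},
    { top_mem := x.2.top_mem
      bot_notMem := x.2.bot_notMem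
      inf_mem := fun _ ha _ hb => x.2.inf_mem _ ha _ hb
      mem_of_le := fun a ha b hab =>
        x.2.mem_of_le _ ha _ ((toModFin_le a.2 b.2).2 (by
          rw [sdiff_eq_empty.2 (show a.1 ⊆ b.1 from hab)]; exact finite_empty))
      mem_or_compl_mem := fun a => x.2.mem_or_compl_mem (toModFin a.2) }⟩

theorem isEmbedding_principalPoint [TopologicalSpace X] [DiscreteTopology X]
    (hT : ∀ q : X, {q} ∈ T) : IsEmbedding (principalPoint T) := by
  refine ⟨⟨?_⟩, fun q r h => ?_⟩
  · refine le_antisymm (continuous_iff_le_induced.1 continuous_of_discreteTopology) ?_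
    intro s _
    rw [← biUnion_of_singleton s]
    refine @isOpen_biUnion _ _ (_) _ _ fun q _ => ?_
    refine isOpen_induced_iff.2 ⟨StoneSpace.basic ⟨{q}, hT q⟩, StoneSpace.isOpen_basic _, ?_⟩
    ext r
    exact Iff.rfl
  · have : (⟨{r}, hT r⟩ : T) ∈ (principalPoint T q).1 := by rw [h]; exact rfl
    exact this

theorem denseRange_principalPoint : DenseRange (principalPoint T) := by
  intro U
  refine mem_closure_iff_nhds.2 fun s hs => ?_
  obtain ⟨a, ha, has⟩ := StoneSpace.exists_basic_subset hs
  obtain ⟨q, hq⟩ : a.1.Nonempty := by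
    rw [nonempty_iff_ne_empty]
    intro h
    rw [show a = ⊥ from Subtype.ext h] at ha
    exact U.2.bot_notMem ha
  exact ⟨_, has hq, q, rfl⟩

theorem isEmbedding_liftPoint : IsEmbedding (liftPoint T) := by
  have hc : Continuous (liftPoint T) := continuous_generateFrom_iff.2 <| by
    rintro _ ⟨a, rfl⟩
    exact StoneSpace.isOpen_basic (toModFin a.2)
  refine (hc.isClosedEmbedding fun x y h => ?_).isEmbedding
  refine Subtype.ext (x.2.eq_of_subset y.2 fun b hb => ?_)
  obtain ⟨a, ha, rfl⟩ := exists_eq_toModFin b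
  have : (⟨a, ha⟩ : T) ∈ (liftPoint T y).1 := by rw [← h]; exact hb
  exact this

/-- An ultrafilter containing a singleton is principal. One containing no singleton contains no
finite set, so it is invariant under finite changes and descends to the quotient. -/
theorem range_liftPoint (hT : ∀ q : X, {q} ∈ T) :
    range (liftPoint T) = (range (principalPoint T))ᶜ := by
  ext U
  constructor
  · rintro ⟨x, rfl⟩ ⟨q, hq⟩
    have h : (⟨{q}, hT q⟩ : T) ∈ (liftPoint T x).1 := by rw [← hq]; exact mem_singleton q
    refine x.2.bot_notMem (x.2.mem_of_le _ h _ ((toModFin_le (hT q) T.bot_mem).2 ?_))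
    exact (finite_singleton q).subset sdiff_subset
  · intro hU
    have hsing : ∀ q, (⟨{q}, hT q⟩ : T) ∉ U.1 := fun q hq => hU ⟨q, by
      refine Subtype.ext (U.2.eq_of_subset (principalPoint T q).2 fun a ha => ?_).symm
      by_contra h
      have := U.2.inf_mem _ hq _ ha
      rw [show (⟨{q}, hT q⟩ : T) ⊓ a = ⊥ from
        Subtype.ext (singleton_inter_eq_empty.2 h)] at this
      exact U.2.bot_notMem this⟩
    have hfin : ∀ (a : Set X) (ha : a.Finite), (⟨a, mem_of_finite hT ha⟩ : T) ∉ U.1 := by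
      intro a ha
      induction a, ha using Set.Finite.induction_on with
      | empty => exact U.2.bot_notMem
      | @insert q s _ hs ih =>
        intro h
        rw [show (⟨insert q s, mem_of_finite hT (hs.insert q)⟩ : T) =
          ⟨{q}, hT q⟩ ⊔ ⟨s, mem_of_finite hT hs⟩ from rfl, U.2.sup_mem_iff] at h
        exact h.elim (hsing q) ih
    have hle : ∀ {a b : Set X} (ha : a ∈ T) (hb : b ∈ T), (a \ b).Finite →
        (⟨a, ha⟩ : T) ∈ U.1 → (⟨b, hb⟩ : T) ∈ U.1 := by
      intro a b ha hb hab h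
      have h' : (⟨a \ b, mem_of_finite hT hab⟩ : T) ⊔ ⟨b, hb⟩ ∈ U.1 :=
        U.2.mem_of_le _ h _ fun q hq => (em (q ∈ b)).elim Or.inr fun hb => Or.inl ⟨hq, hb⟩
      exact (U.2.sup_mem_iff.1 h').resolve_left (hfin _ hab)
    let V : Set T.modFin := {b | ∃ (a : Set X) (ha : a ∈ T), (⟨a, ha⟩ : T) ∈ U.1 ∧ b = toModFin ha}
    have hV : ∀ {a : Set X} (ha : a ∈ T), toModFin ha ∈ V ↔ (⟨a, ha⟩ : T) ∈ U.1 := by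
      refine fun {a} ha => ⟨?_, fun h => ⟨a, ha, h, rfl⟩⟩
      rintro ⟨b, hb, hbU, h⟩
      exact hle hb ha ((toModFin_le hb ha).1 h.ge) hbU
    have hVu : IsUltrafilterOf V :=
      { top_mem := ⟨univ, T.top_mem, U.2.top_mem, rfl⟩
        bot_notMem := fun h => U.2.bot_notMem ((hV T.bot_mem).1 h)
        inf_mem := by
          rintro _ ⟨a, ha, haU, rfl⟩ _ ⟨b, hb, hbU, rfl⟩
          exact ⟨a ∩ b, T.inf_mem ha hb, U.2.inf_mem _ haU _ hbU, rfl⟩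
        mem_of_le := by
          rintro _ ⟨a, ha, haU, rfl⟩ b hab
          obtain ⟨b, hb, rfl⟩ := exists_eq_toModFin b
          exact ⟨b, hb, hle ha hb ((toModFin_le ha hb).1 hab) haU, rfl⟩
        mem_or_compl_mem := fun b => by
          obtain ⟨b, hb, rfl⟩ := exists_eq_toModFin b
          exact (U.2.mem_or_compl_mem ⟨b, hb⟩).imp (fun h => ⟨b, hb, h, rfl⟩)
            fun h => ⟨bᶜ, T.compl_mem hb, h, rfl⟩ }
    exact ⟨⟨V, hVu⟩, Subtype.ext <|
      show {a : T | toModFin a.2 ∈ V} = U.1 from Set.ext fun a => hV a.2⟩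

/-- The compactification is the Stone space of `T` itself, with `X` embedded as the principal
ultrafilters. -/
theorem isGrowthOfOmega {X : Type} [Countable X] [Infinite X] {T : BooleanSubalgebra (Set X)}
    (hT : ∀ q : X, {q} ∈ T) : IsGrowthOfOmega (StoneSpace T.modFin) := by
  obtain ⟨φ⟩ : Nonempty (ℕ ≃ X) := nonempty_equiv_of_countable
  let _ : TopologicalSpace X := ⊥
  have _ : DiscreteTopology X := ⟨rfl⟩
  refine ⟨StoneSpace T, inferInstance, inferInstance, inferInstance, principalPoint T ∘ φ,
    (isEmbedding_principalPoint hT).comp (φ.toHomeomorphOfDiscrete).isEmbedding,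
    denseRange_principalPoint.comp φ.surjective.denseRange continuous_of_discreteTopology,
    ⟨isEmbedding_liftPoint.toHomeomorph.trans (Homeomorph.setCongr ?_)⟩⟩
  rw [range_liftPoint hT, φ.surjective.range_comp]

end BooleanSubalgebra

namespace Slalom

/-! ### Boxes and nodes -/

theorem finite_box (n : ℕ) : (box n).Finite := (finite_Iio n).prod (finite_Iio _)

theorem box_mono : Monotone box := fun _ _ h _ hp =>
  ⟨hp.1.trans_le h, lt_of_lt_of_le hp.2 (Nat.pow_le_pow_right two_pos h)⟩

theorem exists_mem_box (p : ℕ × ℕ) : ∃ n, p ∈ box n :=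
  ⟨p.1 + p.2 + 1, show p.1 < p.1 + p.2 + 1 by omega,
    (show p.2 < p.1 + p.2 + 1 by omega).trans_le Nat.lt_two_pow_self.le⟩

theorem exists_subset_box {F : Set (ℕ × ℕ)} (hF : F.Finite) : ∃ n, F ⊆ box n := by
  choose f hf using exists_mem_box
  obtain ⟨n, hn⟩ := (hF.image f).bddAbove
  exact ⟨n, fun p hp => box_mono (hn (mem_image_of_mem f hp)) (hf p)⟩

theorem IsSlalom.mono {S T : Set (ℕ × ℕ)} (hT : IsSlalom T) (h : S ⊆ T) : IsSlalom S := fun n =>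
  (encard_le_encard (show sec S n ⊆ sec T n from fun _ hm => h hm)).trans_lt (hT n)

theorem IsSlalom.finite_sec {S : Set (ℕ × ℕ)} (hS : IsSlalom S) (n : ℕ) : (sec S n).Finite :=
  encard_lt_top_iff.1 ((hS n).trans (ENat.natCast_lt_top _))

theorem isSlalom_empty : IsSlalom ∅ := fun n => by
  rw [show sec ∅ n = ∅ from rfl, encard_empty]
  exact_mod_cast Nat.two_pow_pos n

/-- The node `(S ∩ (n × 2 ^ n), n)`. -/
def IsSlalom.node {S : Set (ℕ × ℕ)} (hS : IsSlalom S) (n : ℕ) : Node :=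
  ⟨(S ∩ box n, n), hS.mono inter_subset_left, inter_subset_right⟩

theorem Node.ext {q r : Node} (h₁ : q.1.1 = r.1.1) (h₂ : q.1.2 = r.1.2) : q = r :=
  Subtype.ext (Prod.ext h₁ h₂)

theorem Node.isSlalom (q : Node) : IsSlalom q.1.1 := q.2.1

theorem Node.subset_box (q : Node) : q.1.1 ⊆ box q.1.2 := q.2.2

theorem finite_setOf_level_le (n : ℕ) : {q : Node | q.1.2 ≤ n}.Finite := by
  have h : (𝒫 (box n) ×ˢ Iic n).Finite := (finite_box n).finite_subsets.prod (finite_Iic n)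
  refine (h.preimage Subtype.val_injective.injOn).subset fun (q : Node) hq => ?_
  exact ⟨q.subset_box.trans (box_mono hq), hq⟩

instance : Countable Node := by
  rw [← countable_univ_iff, show (univ : Set Node) = ⋃ n, {q : Node | q.1.2 ≤ n} from
    (eq_univ_of_forall fun q => mem_iUnion.2 ⟨q.1.2, le_refl q.1.2⟩).symm]
  exact countable_iUnion fun n => (finite_setOf_level_le n).countable

theorem IsSlalom.node_injective {S : Set (ℕ × ℕ)} (hS : IsSlalom S) :
    Function.Injective hS.node := fun _ _ h => congrArg (fun q : Node => q.1.2) h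

instance : Infinite Node := .of_injective _ isSlalom_empty.node_injective

/-! ### The algebra -/

section Algebra

variable {𝒜 : Set (Set (ℕ × ℕ))}

theorem above_mem_treeAlg {A : Set (ℕ × ℕ)} (hA : A ∈ 𝒜) : above A ∈ treeAlg 𝒜 :=
  BooleanSubalgebra.subset_closure (.inl ⟨A, hA, rfl⟩)

theorem cone_mem_treeAlg (q : Node) : cone q ∈ treeAlg 𝒜 :=
  BooleanSubalgebra.subset_closure (.inr ⟨q, rfl⟩)

theorem biUnion_cone_mem_treeAlg {s : Set Node} (hs : s.Finite) :
    ⋃ q ∈ s, cone q ∈ treeAlg 𝒜 := by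
  induction s, hs using Set.Finite.induction_on with
  | empty => simpa using (treeAlg 𝒜).bot_mem
  | insert _ _ ih =>
    rw [biUnion_insert]
    exact BooleanSubalgebra.sup_mem (cone_mem_treeAlg _) ih

/-- Every node of level above that of `q` lies in the cone of its restriction to the next level, and
there are finitely many nodes of that level. -/
theorem singleton_mem_treeAlg (q : Node) : {q} ∈ treeAlg 𝒜 := by
  have h : {q} = cone q \ ⋃ r ∈ {r : Node | r.1.2 = q.1.2 + 1}, cone r := by
    refine Subset.antisymm (singleton_subset_iff.2 ⟨⟨le_rfl, ?_⟩, ?_⟩) fun r hr => ?_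
    · exact inter_eq_left.2 q.subset_box
    · simp only [mem_iUnion, not_exists]
      rintro r hr ⟨h, -⟩
      rw [mem_ofPred_eq] at hr
      omega
    · obtain ⟨⟨h₁, h₂⟩, h₃⟩ := hr
      simp only [mem_iUnion, not_exists] at h₃
      have h₄ : r.1.2 = q.1.2 := by
        by_contra hne
        exact h₃ (r.isSlalom.node (q.1.2 + 1)) rfl
          ⟨Nat.succ_le_of_lt (lt_of_le_of_ne h₁ (Ne.symm hne)), rfl⟩
      refine Node.ext ?_ h₄
      rw [← h₂, ← h₄, inter_eq_left.2 r.subset_box]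
  rw [h]
  refine BooleanSubalgebra.sdiff_mem (cone_mem_treeAlg q) (biUnion_cone_mem_treeAlg ?_)
  exact (finite_setOf_level_le (q.1.2 + 1)).subset fun r hr => hr.le

/-- The nodes containing a given point. -/
def containing (p : ℕ × ℕ) : Set Node := {q | p ∈ q.1.1}

/-- Once the box of level `n` contains `p`, membership of `p` in a node of level at least `n`
depends only on its trace on that box; only finitely many nodes lie below. -/
theorem containing_mem_treeAlg (p : ℕ × ℕ) : containing p ∈ treeAlg 𝒜 := by
  obtain ⟨n, hn⟩ := exists_mem_box p
  have h : containing p = (containing p ∩ {q : Node | q.1.2 ≤ n}) ∪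
      ⋃ r ∈ {r : Node | r.1.2 = n ∧ p ∈ r.1.1}, cone r := by
    refine Subset.antisymm (fun q hq => ?_) (union_subset inter_subset_left ?_)
    · rcases le_total q.1.2 n with h | h
      · exact .inl ⟨hq, h⟩
      · exact .inr (mem_biUnion (x := q.isSlalom.node n) ⟨rfl, hq, hn⟩ ⟨h, rfl⟩)
    · simp only [iUnion_subset_iff]
      rintro r ⟨-, hr⟩ q ⟨-, hq⟩
      exact (hq ▸ hr : p ∈ q.1.1 ∩ _).1
  rw [h]
  refine BooleanSubalgebra.sup_mem ?_ (biUnion_cone_mem_treeAlg ?_)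
  · exact BooleanSubalgebra.mem_of_finite singleton_mem_treeAlg
      ((finite_setOf_level_le n).subset inter_subset_right)
  · exact (finite_setOf_level_le n).subset fun r hr => hr.1.le

end Algebra

/-! ### The branch of a nonprincipal ultrafilter -/

/-- The union of the traces of the members of `u` on the boxes. -/
def branch (u : Ultrafilter Node) : Set (ℕ × ℕ) := {p | containing p ∈ u}

section Branch

variable {u : Ultrafilter Node} (hu : (u : Filter Node) ≤ Filter.cofinite)
include hu

theorem eventually_le_level (n : ℕ) : ∀ᶠ q : Node in u, n ≤ q.1.2 := by
  refine Filter.mem_of_superset (hu (finite_setOf_level_le n).compl_mem_cofinite) fun q hq => ?_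
  exact (not_le.1 (show ¬ q.1.2 ≤ n from hq)).le

omit hu in
theorem eventually_inter_box (n : ℕ) : ∀ᶠ q : Node in u, q.1.1 ∩ box n = branch u ∩ box n := by
  have h : ∀ᶠ q : Node in u, ∀ p ∈ box n, (p ∈ q.1.1 ↔ p ∈ branch u) := by
    refine (Filter.eventually_all_finite (finite_box n)).2 fun p _ => ?_
    by_cases hp : p ∈ branch u
    · filter_upwards [hp] with q hq using iff_of_true hq hp
    · filter_upwards [Ultrafilter.compl_mem_iff_notMem.2 hp] with q hq using iff_of_false hq hp
  filter_upwards [h] with q hq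
  ext p
  simp only [mem_inter_iff]
  exact ⟨fun h => ⟨(hq p h.2).1 h.1, h.2⟩, fun h => ⟨(hq p h.2).2 h.1, h.2⟩⟩

omit hu in
theorem isSlalom_branch : IsSlalom (branch u) := by
  intro i
  by_contra! h
  obtain ⟨t, ht, hcard⟩ := exists_subset_encard_eq h
  have hfin : t.Finite := by
    rw [← encard_lt_top_iff, hcard]
    exact ENat.natCast_lt_top _
  -- Some node agrees with the branch on a box containing `2 ^ i` points of the offending section,
  -- against the node being a slalom.
  obtain ⟨n, hn⟩ := exists_subset_box (hfin.image fun m => (i, m))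
  obtain ⟨q, hq⟩ := (eventually_inter_box (u := u) n).exists
  refine (q.isSlalom i).not_ge (hcard.symm.le.trans (encard_le_encard fun m hm => ?_))
  have : (i, m) ∈ branch u ∩ box n := ⟨ht hm, hn (mem_image_of_mem _ hm)⟩
  rw [← hq] at this
  exact this.1

theorem subset_branch {A : Set (ℕ × ℕ)} (hA : above A ∈ u) : A ⊆ branch u := by
  intro p hp
  obtain ⟨n, hn⟩ := exists_mem_box p
  filter_upwards [hA, eventually_le_level hu n] with q hq hnq
  exact hq ⟨hp, box_mono hnq hn⟩

omit hu in
-- The finite set `A \ A'` sits in a box on which `u`-almost every node agrees with the branch, and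
-- the branch contains `A`. This is what makes traces over a common branch comparable.
theorem above_mem_of_almostSubset {A A' : Set (ℕ × ℕ)} (hA' : above A' ∈ u)
    (h : AlmostSubset A A') (hA : A ⊆ branch u) : above A ∈ u := by
  obtain ⟨n, hn⟩ := exists_subset_box h
  filter_upwards [hA', eventually_inter_box n] with q hq hnq p hp
  by_cases hpA : p ∈ A'
  · exact hq ⟨hpA, hp.2⟩
  · have : p ∈ branch u ∩ box n := ⟨hA hp.1, hn ⟨hp.1, hpA⟩⟩
    rw [← hnq] at this
    exact this.1

theorem cone_mem_iff {q : Node} : cone q ∈ u ↔ branch u ∩ box q.1.2 = q.1.1 := by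
  refine ⟨fun h => ?_, fun h => ?_⟩
  · obtain ⟨r, hr, hr'⟩ := (Filter.inter_mem h (eventually_inter_box q.1.2) |> u.nonempty_of_mem)
    exact hr'.symm.trans hr.2
  · filter_upwards [eventually_inter_box q.1.2, eventually_le_level hu q.1.2] with r hr hr'
    exact ⟨hr', hr.trans h⟩

end Branch

/-! ### The canonical ultrafilter on a branch -/

/-- A nonprincipal ultrafilter concentrated on the nodes `(B ∩ (n × 2 ^ n), n)`. -/
noncomputable def IsSlalom.ultrafilter {B : Set (ℕ × ℕ)} (hB : IsSlalom B) : Ultrafilter Node :=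
  (Filter.hyperfilter ℕ).map hB.node

section Canonical

variable {B : Set (ℕ × ℕ)} (hB : IsSlalom B)

theorem IsSlalom.ultrafilter_le : (hB.ultrafilter : Filter Node) ≤ Filter.cofinite :=
  (Filter.map_mono Filter.hyperfilter_le_cofinite).trans hB.node_injective.tendsto_cofinite

theorem IsSlalom.mem_ultrafilter {s : Set Node} (n : ℕ) (h : ∀ m ≥ n, hB.node m ∈ s) :
    s ∈ hB.ultrafilter := by
  refine Ultrafilter.mem_map.2 (Filter.hyperfilter_le_cofinite ?_)
  refine (finite_lt_nat n).subset fun m hm => ?_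
  by_contra h'
  exact hm (h m (not_lt.1 h'))

theorem IsSlalom.branch_ultrafilter : branch hB.ultrafilter = B := by
  ext p
  obtain ⟨n, hn⟩ := exists_mem_box p
  constructor
  · intro hp
    obtain ⟨m, hm⟩ := Ultrafilter.nonempty_of_mem (Ultrafilter.mem_map.1 hp)
    exact hm.1
  · exact fun hp => hB.mem_ultrafilter n fun m hm => ⟨hp, box_mono hm hn⟩

/-- On a canonical ultrafilter the necessary condition of `subset_branch` is also sufficient: its
trace is the largest one that the branch allows. -/
theorem IsSlalom.above_mem_ultrafilter {A : Set (ℕ × ℕ)} : above A ∈ hB.ultrafilter ↔ A ⊆ B := by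
  constructor
  · intro h
    have := subset_branch hB.ultrafilter_le h
    rwa [hB.branch_ultrafilter] at this
  · exact fun h => hB.mem_ultrafilter 0 fun m _ => inter_subset_inter_left _ h

theorem IsSlalom.cone_mem_ultrafilter {q : Node} :
    cone q ∈ hB.ultrafilter ↔ B ∩ box q.1.2 = q.1.1 := by
  rw [cone_mem_iff hB.ultrafilter_le, hB.branch_ultrafilter]

end Canonical

end Slalom

namespace Slalom

/-! ### Almost inclusion -/

theorem AlmostSubset.of_subset {A B : Set (ℕ × ℕ)} (h : A ⊆ B) : AlmostSubset A B := by
  rw [AlmostSubset, sdiff_eq_empty.2 h]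
  exact finite_empty

theorem AlmostSubset.trans {A B C : Set (ℕ × ℕ)} (h₁ : AlmostSubset A B)
    (h₂ : AlmostSubset B C) : AlmostSubset A C :=
  (h₁.union h₂).subset fun x hx => by
    simp only [mem_union, mem_sdiff] at *
    tauto

theorem AlmostEq.le {A B : Set (ℕ × ℕ)} (h : AlmostEq A B) : AlmostSubset A B :=
  h.subset subset_union_left

theorem AlmostEq.ge {A B : Set (ℕ × ℕ)} (h : AlmostEq A B) : AlmostSubset B A :=
  h.subset subset_union_right

/-- The part of `D` from level `m` on. -/
def tail (D : Set (ℕ × ℕ)) (m : ℕ) : Set (ℕ × ℕ) := {p ∈ D | m ≤ p.1}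

theorem tail_subset (D : Set (ℕ × ℕ)) (m : ℕ) : tail D m ⊆ D := sep_subset _ _

theorem almostSubset_tail {D : Set (ℕ × ℕ)} (hD : ∀ n, (sec D n).Finite) (m : ℕ) :
    AlmostSubset D (tail D m) := by
  have : (⋃ i ∈ Iio m, (fun j => (i, j)) '' sec D i).Finite :=
    (finite_Iio m).biUnion fun i _ => (hD i).image _
  refine this.subset fun p hp => mem_biUnion (x := p.1) ?_ ⟨p.2, hp.1, rfl⟩
  by_contra h
  exact hp.2 ⟨hp.1, not_lt.1 h⟩

theorem IsSlalom.union_tail {S D : Set (ℕ × ℕ)} (hS : IsSlalom S) (hD : IsSlalom D) {m : ℕ}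
    (h : S ⊆ box m) : IsSlalom (S ∪ tail D m) := by
  intro i
  rcases lt_or_ge i m with hi | hi
  · refine (encard_le_encard fun j hj => ?_).trans_lt (hS i)
    exact Or.elim hj id fun hj => absurd hj.2 (not_le.2 hi)
  · refine (encard_le_encard fun j hj => ?_).trans_lt (hD i)
    exact Or.elim hj (fun hj => absurd (h hj).1 (not_lt.2 hi)) fun hj => hj.1

theorem Node.isSlalom_union_tail (q : Node) {D : Set (ℕ × ℕ)} (hD : IsSlalom D) :
    IsSlalom (q.1.1 ∪ tail D q.1.2) :=
  q.isSlalom.union_tail hD q.subset_box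

theorem Node.union_tail_inter_box (q : Node) (D : Set (ℕ × ℕ)) :
    (q.1.1 ∪ tail D q.1.2) ∩ box q.1.2 = q.1.1 := by
  refine Subset.antisymm (fun p hp => ?_) fun p hp => ⟨.inl hp, q.subset_box hp⟩
  exact hp.1.resolve_right fun h => h.2.not_gt hp.2.1

theorem Node.almostEq_union_tail (q : Node) {D : Set (ℕ × ℕ)} (hD : IsSlalom D) :
    AlmostEq (q.1.1 ∪ tail D q.1.2) D := by
  refine (((finite_box q.1.2).subset q.subset_box).union (almostSubset_tail hD.finite_sec q.1.2)).subset ?_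
  intro p hp
  rcases hp with ⟨hp | hp, hp'⟩ | ⟨hp, hp'⟩
  · exact .inl hp
  · exact absurd hp.1 hp'
  · exact .inr ⟨hp, fun h => hp' (.inr h)⟩

/-! ### Unbounded towers -/

/-- A `⊆*`-increasing family in `𝒲` that no slalom bounds. -/
structure IsTower {ι : Type*} [LinearOrder ι] (A : ι → Set (ℕ × ℕ)) : Prop where
  mem : ∀ α, IsSummableSlalom (A α)
  mono : ∀ α β, α ≤ β → AlmostSubset (A α) (A β)
  unbounded : ∀ S, IsSlalom S → ∃ α, ¬ AlmostSubset (A α) S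

theorem IsUnboundedChain.isTower {κ : Cardinal.{0}} {A : Set.Iio κ.ord → Set (ℕ × ℕ)}
    (h : IsUnboundedChain κ A) : IsTower A where
  mem := h.mem
  mono α β hαβ := hαβ.eq_or_lt.elim (fun h => h ▸ .of_subset Subset.rfl) (h.mono α β)
  unbounded := h.unbounded

/-- The algebra attached to a family of slaloms. -/
abbrev towerAlg {ι : Type*} (A : ι → Set (ℕ × ℕ)) : BooleanSubalgebra (Set Node) :=
  treeAlg (finiteModClosure A)

/-- The space attached to a family of slaloms. -/
abbrev TowerSpace {ι : Type*} (A : ι → Set (ℕ × ℕ)) : Type :=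
  StoneSpace (towerAlg A).modFin

section Tower

open BooleanSubalgebra StoneSpace

variable {ι : Type*} [LinearOrder ι] {A : ι → Set (ℕ × ℕ)}

/-! ### Neighbourhood bases and local π-bases -/

namespace IsTower

variable (hA : IsTower A)
include hA

theorem isSlalom (α : ι) : IsSlalom (A α) := (hA.mem α).1

theorem almostSubset_total {E E' : Set (ℕ × ℕ)} (hE : E ∈ finiteModClosure A)
    (hE' : E' ∈ finiteModClosure A) : AlmostSubset E E' ∨ AlmostSubset E' E := by
  obtain ⟨-, α, hα⟩ := hE
  obtain ⟨-, β, hβ⟩ := hE'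
  exact (le_total α β).imp (fun h => (hα.le.trans (hA.mono _ _ h)).trans hβ.ge)
    fun h => (hβ.le.trans (hA.mono _ _ h)).trans hα.ge

theorem union_tail_mem (q : Node) (δ : ι) :
    q.1.1 ∪ tail (A δ) q.1.2 ∈ finiteModClosure A :=
  ⟨q.isSlalom_union_tail (hA.isSlalom δ), δ, q.almostEq_union_tail (hA.isSlalom δ)⟩

/-- Take `δ` with `A δ` not almost contained in `B`. If `E =* A α` and `E ⊆ B`, then `δ ≤ α` would
give `A δ ⊆* B`. -/
theorem exists_forall_almostSubset {B : Set (ℕ × ℕ)} (hB : IsSlalom B) :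
    ∃ δ, ∀ E ∈ finiteModClosure A, E ⊆ B → AlmostSubset E (A δ) := by
  obtain ⟨δ, hδ⟩ := hA.unbounded B hB
  refine ⟨δ, fun E ⟨_, α, hα⟩ hEB => hα.le.trans (hA.mono _ _ (le_of_not_ge fun h => hδ ?_))⟩
  exact ((hA.mono _ _ h).trans hα.ge).trans (.of_subset hEB)

/-- A neighbourhood base: every member of the algebra is decided by a cone, one set `above E` in
the ultrafilter and finitely many sets `above E'` outside it. -/
theorem exists_base {u : Ultrafilter Node} (hu : (u : Filter Node) ≤ Filter.cofinite)
    {a : Set Node} (ha : a ∈ towerAlg A) :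
    ∃ (n : ℕ) (E : Set (ℕ × ℕ)) (G : Set (Set (ℕ × ℕ))),
      (E = ∅ ∨ E ∈ finiteModClosure A) ∧ above E ∈ u ∧ G.Finite ∧
      (∀ E' ∈ G, E' ∈ finiteModClosure A ∧ above E' ∉ u) ∧
      (cone ((isSlalom_branch (u := u)).node n) ∩ above E ⊆ a ∪ ⋃ E' ∈ G, above E' ∨
        cone ((isSlalom_branch (u := u)).node n) ∩ above E ⊆ aᶜ ∪ ⋃ E' ∈ G, above E') := by
  have hempty : above ∅ ∈ u := by
    rw [show above ∅ = univ from eq_univ_of_forall fun q p hp => hp.1.elim]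
    exact Filter.univ_mem
  have hcone : ∀ {m n}, m ≤ n → cone ((isSlalom_branch (u := u)).node n) ⊆
      cone ((isSlalom_branch (u := u)).node m) := by
    rintro m n h q ⟨hq, hq'⟩
    refine ⟨h.trans hq, ?_⟩
    change q.1.1 ∩ box m = branch u ∩ box m
    rw [← inter_eq_right.2 (box_mono h), ← inter_assoc, ← inter_assoc]
    exact congrArg (· ∩ box m) hq'
  induction ha using BooleanSubalgebra.closure_bot_sup_induction with
  | mem a ha =>
    rcases ha with ⟨E, hE, rfl⟩ | ⟨q, rfl⟩
    · by_cases h : above E ∈ u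
      · exact ⟨0, E, ∅, .inr hE, h, finite_empty, by simp,
          .inl (inter_subset_right.trans subset_union_left)⟩
      -- The default `E = ∅` imposes no condition, and `E` itself goes on the list of excluded sets.
      · refine ⟨0, ∅, {E}, .inl rfl, hempty, finite_singleton E, ?_, .inr ?_⟩
        · rintro _ rfl
          exact ⟨hE, h⟩
        · simp
    · refine ⟨q.1.2, ∅, ∅, .inl rfl, hempty, finite_empty, by simp, ?_⟩
      by_cases h : branch u ∩ box q.1.2 = q.1.1
      · refine .inl (inter_subset_left.trans (subset_union_of_subset_left ?_ _))
        exact fun r hr => ⟨hr.1, hr.2.trans h⟩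
      · refine .inr (inter_subset_left.trans (subset_union_of_subset_left ?_ _))
        exact fun r hr hr' => h (hr.2.symm.trans hr'.2)
  | bot => exact ⟨0, ∅, ∅, .inl rfl, hempty, finite_empty, by simp, .inr (by simp)⟩
  | sup a _ b _ iha ihb =>
    obtain ⟨n, E, G, hE, hEu, hG, hG', h⟩ := iha
    obtain ⟨n', E', G', hE', hEu', hH, hH', h'⟩ := ihb
    -- Two positive requirements merge into one: the `⊆*`-larger set, together with a cone long
    -- enough to settle the finite difference, implies the other.
    obtain ⟨k, F, hF, hFu, hk⟩ : ∃ (k : ℕ) (F : Set (ℕ × ℕ)), (F = ∅ ∨ F ∈ finiteModClosure A) ∧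
        above F ∈ u ∧ cone ((isSlalom_branch (u := u)).node k) ∩ above F ⊆
          above E ∩ above E' := by
      have key : ∀ {E E' : Set (ℕ × ℕ)}, above E ∈ u → AlmostSubset E E' →
          ∃ k, cone ((isSlalom_branch (u := u)).node k) ∩ above E' ⊆ above E ∩ above E' := by
        intro E E' hEu h
        obtain ⟨k, hk⟩ := exists_subset_box h
        refine ⟨k, fun q hq => ⟨fun p hp => ?_, hq.2⟩⟩
        by_cases hpE : p ∈ E'
        · exact hq.2 ⟨hpE, hp.2⟩
        · have : p ∈ branch u ∩ box k := ⟨subset_branch hu hEu hp.1, hk ⟨hp.1, hpE⟩⟩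
          rw [show branch u ∩ box k = q.1.1 ∩ box k from hq.1.2.symm] at this
          exact this.1
      have htot : AlmostSubset E E' ∨ AlmostSubset E' E := by
        rcases hE with rfl | hE
        · exact .inl (.of_subset (empty_subset _))
        rcases hE' with rfl | hE'
        · exact .inr (.of_subset (empty_subset _))
        exact hA.almostSubset_total hE hE'
      rcases htot with h | h
      · obtain ⟨k, hk⟩ := key hEu h
        exact ⟨k, E', hE', hEu', hk⟩
      · obtain ⟨k, hk⟩ := key hEu' h
        exact ⟨k, E, hE, hEu, hk.trans (inter_comm _ _).subset⟩
    refine ⟨max k (max n n'), F, G ∪ G', hF, hFu, hG.union hH, ?_, ?_⟩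
    · rintro E (hE | hE)
      exacts [hG' E hE, hH' E hE]
    · have h₁ := hcone (le_max_left k (max n n'))
      have h₂ := hcone ((le_max_left n n').trans (le_max_right k _))
      have h₃ := hcone ((le_max_right n n').trans (le_max_right k _))
      have h₄ : ∀ q ∈ cone ((isSlalom_branch (u := u)).node (max k (max n n'))) ∩ above F,
          q ∈ above E ∧ q ∈ above E' := fun q hq => hk ⟨h₁ hq.1, hq.2⟩
      rw [biUnion_union]
      rcases h with h | h
      · refine .inl fun q hq => ?_
        rcases h ⟨h₂ hq.1, (h₄ q hq).1⟩ with h | h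
        exacts [.inl (.inl h), .inr (.inl h)]
      rcases h' with h' | h'
      · refine .inl fun q hq => ?_
        rcases h' ⟨h₃ hq.1, (h₄ q hq).2⟩ with h | h
        exacts [.inl (.inr h), .inr (.inr h)]
      · refine .inr fun q hq => ?_
        rcases h ⟨h₂ hq.1, (h₄ q hq).1⟩ with h | h
        · rcases h' ⟨h₃ hq.1, (h₄ q hq).2⟩ with h' | h'
          · exact .inl fun h'' => h''.elim h h'
          · exact .inr (.inr h')
        · exact .inr (.inl h)
  | compl a _ ih =>
    obtain ⟨n, E, G, hE, hEu, hG, hG', h⟩ := ih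
    exact ⟨n, E, G, hE, hEu, hG, hG', by rw [compl_compl]; exact h.symm⟩

/-- At every point there is `δ` such that every neighbourhood contains a set of the form
`cone q ∩ above (q ∪ tail (A δ))`. -/
theorem exists_piBase {u : Ultrafilter Node} (hu : (u : Filter Node) ≤ Filter.cofinite) :
    ∃ δ, ∀ a ∈ towerAlg A, a ∈ u →
      ∃ q : Node, cone q ∩ above (q.1.1 ∪ tail (A δ) q.1.2) ⊆ a := by
  have hB := isSlalom_branch (u := u)
  obtain ⟨δ, hδ⟩ := hA.exists_forall_almostSubset hB
  refine ⟨δ, fun a ha hau => ?_⟩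
  obtain ⟨n, E, G, hE, hEu, hG, hG', h⟩ := hA.exists_base hu ha
  have hEB : E ⊆ branch u := subset_branch hu hEu
  have hEδ : AlmostSubset E (A δ) :=
    hE.elim (fun h => h ▸ .of_subset (empty_subset _)) fun h => hδ E h hEB
  -- The alternative with `aᶜ` fails, since `u` contains `a`, the cone and `above E`, but none of
  -- the finitely many `above E'`.
  have hsub : cone (hB.node n) ∩ above E ⊆ a ∪ ⋃ E' ∈ G, above E' := by
    refine h.resolve_right fun h => ?_
    have h₁ : cone (hB.node n) ∈ u := (cone_mem_iff hu).2 rfl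
    have h₂ : (⋃ E' ∈ G, above E') ∉ u := by
      rw [Ultrafilter.finite_biUnion_mem_iff hG]
      rintro ⟨E', hE', h⟩
      exact (hG' E' hE').2 h
    have h₃ := Filter.mem_of_superset (Filter.inter_mem h₁ hEu) h
    rcases Ultrafilter.union_mem_iff.1 h₃ with h₃ | h₃
    · exact Ultrafilter.compl_notMem_iff.2 hau h₃
    · exact h₂ h₃
  -- Otherwise `E' ⊆* E` and `E' ⊆ branch u`, which would put `above E'` into `u`.
  have hwit : ∀ E' ∈ G, ∃ p ∈ E', p ∉ (branch u ∩ box n) ∪ E := by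
    intro E' hE'
    by_contra! hsub'
    refine (hG' E' hE').2 (above_mem_of_almostSubset hEu ?_ fun p hp => ?_)
    · exact (finite_box n).subset fun p hp => ((hsub' p hp.1).resolve_right hp.2).2
    · exact (hsub' p hp).elim (fun h => h.1) fun h => hEB h
  choose! w hw hw' using hwit
  obtain ⟨m₁, hm₁⟩ := exists_subset_box hEδ
  obtain ⟨m₂, hm₂⟩ := exists_subset_box (hG.image w)
  -- The box of level `m` contains `E \ A δ` and all the witnesses. The node `q` below contains no
  -- witness, so no node of its cone is in any `above E'`; inside the box it contains `E`, and
  -- outside the box `A δ` contains `E`.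
  set m := max n (max m₁ m₂)
  have hTB : (branch u ∩ box n) ∪ (E ∩ box m) ⊆ branch u :=
    union_subset inter_subset_left (inter_subset_left.trans hEB)
  let q : Node := ⟨((branch u ∩ box n) ∪ (E ∩ box m), m), hB.mono hTB,
    union_subset (inter_subset_right.trans (box_mono (le_max_left _ _))) inter_subset_right⟩
  refine ⟨q, fun r ⟨⟨hr, hr'⟩, hrD⟩ => ?_⟩
  have hr' : r.1.1 ∩ box m = (branch u ∩ box n) ∪ (E ∩ box m) := hr'
  have hr : m ≤ r.1.2 := hr
  refine (hsub ⟨⟨(le_max_left _ _).trans hr, ?_⟩, fun p hp => ?_⟩).resolve_right fun hrG => ?_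
  · change r.1.1 ∩ box n = branch u ∩ box n
    have hnm : box n ⊆ box m := box_mono (le_max_left _ _)
    ext p
    constructor
    · rintro ⟨h, hp⟩
      have : p ∈ r.1.1 ∩ box m := ⟨h, hnm hp⟩
      rw [hr'] at this
      exact ⟨hTB this, hp⟩
    · intro hp
      have : p ∈ r.1.1 ∩ box m := by rw [hr']; exact .inl hp
      exact ⟨this.1, hp.2⟩
  · by_cases hpm : p ∈ box m
    · have : p ∈ r.1.1 ∩ box m := by rw [hr']; exact .inr ⟨hp.1, hpm⟩
      exact this.1
    · have hpδ : p ∈ A δ := by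
        by_contra h
        exact hpm (box_mono ((le_max_left _ _).trans (le_max_right _ _)) (hm₁ ⟨hp.1, h⟩))
      refine hrD ⟨.inr ⟨hpδ, ?_⟩, hp.2⟩
      -- Members of `𝒲` lie below `2 ^ i` at level `i`, so a point of `A δ` outside the box has
      -- level at least `m`.
      change m ≤ p.1
      by_contra! hlt
      have hp2 : p.2 < 2 ^ p.1 := (hA.mem δ).2.1 p.1 hpδ
      exact hpm ⟨hlt, hp2.trans_le (Nat.pow_le_pow_right two_pos hlt.le)⟩
  · simp only [mem_iUnion, exists_prop] at hrG
    obtain ⟨E', hE', hrE'⟩ := hrG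
    have hwm : w E' ∈ box m := box_mono ((le_max_right _ _).trans (le_max_right _ _))
      (hm₂ (mem_image_of_mem w hE'))
    have : w E' ∈ r.1.1 ∩ box m := ⟨hrE' ⟨hw E' hE', box_mono hr hwm⟩, hwm⟩
    rw [hr'] at this
    exact hw' E' hE' (this.imp_right fun h => h.1)

/-- The index `δ` depends on the point only, and `q` runs through the countable set of nodes. -/
theorem hasCountablePiCharacter : HasCountablePiCharacter (TowerSpace A) := by
  intro x
  obtain ⟨u, hu, rfl⟩ := exists_stonePoint_eq x
  obtain ⟨δ, hδ⟩ := hA.exists_piBase hu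
  let V : Node → Set (TowerSpace A) := fun q =>
    basic (toModFin (cone_mem_treeAlg q)) ∩
      basic (toModFin (above_mem_treeAlg (hA.union_tail_mem q δ)))
  refine ⟨range V, countable_range V, ?_, fun U hU => ?_⟩
  · rintro _ ⟨q, rfl⟩
    have hS := q.isSlalom_union_tail (hA.isSlalom δ)
    refine ⟨(isOpen_basic _).inter (isOpen_basic _), stonePoint _ _ hS.ultrafilter_le,
      (toModFin_mem_stonePoint hS.ultrafilter_le _).2 ?_,
      (toModFin_mem_stonePoint hS.ultrafilter_le _).2 ?_⟩
    · exact hS.cone_mem_ultrafilter.2 (q.union_tail_inter_box _)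
    · exact hS.above_mem_ultrafilter.2 Subset.rfl
  · obtain ⟨b, hb, hbU⟩ := exists_basic_subset hU
    obtain ⟨a, ha, rfl⟩ := exists_eq_toModFin b
    obtain ⟨q, hq⟩ := hδ a ha ((toModFin_mem_stonePoint hu ha).1 hb)
    refine ⟨V q, mem_range_self q, fun y hy => hbU ?_⟩
    obtain ⟨v, hv, rfl⟩ := exists_stonePoint_eq y
    refine (toModFin_mem_stonePoint hv ha).2 (Filter.mem_of_superset ?_ hq)
    exact Filter.inter_mem ((toModFin_mem_stonePoint hv _).1 hy.1) ((toModFin_mem_stonePoint hv _).1 hy.2)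

end IsTower

end Tower

end Slalom

namespace Slalom

/-! ### The weight of a set -/

/-- The measure on `ω × ω` giving mass `2⁻ⁿ` to `(n, m)`. -/
noncomputable def weight : Measure (ℕ × ℕ) :=
  Measure.count.withDensity fun p => (2⁻¹ : ENNReal) ^ p.1

theorem weight_apply (S : Set (ℕ × ℕ)) : weight S = ∑' p : S, (2⁻¹ : ENNReal) ^ p.1.1 := by
  rw [weight, withDensity_apply _ (.of_discrete), ← lintegral_indicator (.of_discrete),
    lintegral_count, tsum_subtype S fun p : ℕ × ℕ => (2⁻¹ : ENNReal) ^ p.1]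

theorem weight_eq_tsum (S : Set (ℕ × ℕ)) :
    weight S = ∑' n, ((sec S n).encard : ENNReal) * (2⁻¹ : ENNReal) ^ n := by
  rw [weight_apply, tsum_subtype S fun p : ℕ × ℕ => (2⁻¹ : ENNReal) ^ p.1, ENNReal.tsum_prod']
  refine tsum_congr fun n => ?_
  rw [show (fun m => S.indicator (fun p : ℕ × ℕ => (2⁻¹ : ENNReal) ^ p.1) (n, m)) =
    (sec S n).indicator fun _ => (2⁻¹ : ENNReal) ^ n from rfl, ← tsum_subtype,
    ENNReal.tsum_set_const]

theorem summable_iff_weight_ne_top {S : Set (ℕ × ℕ)} (hS : ∀ n, (sec S n).Finite) :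
    (Summable fun n => ((sec S n).ncard : ℝ) / 2 ^ n) ↔ weight S ≠ ⊤ := by
  have h : ∀ n, ((sec S n).encard : ENNReal) * (2⁻¹ : ENNReal) ^ n =
      ENNReal.ofReal (((sec S n).ncard : ℝ) / 2 ^ n) := fun n => by
    rw [← (hS n).cast_ncard_eq, ENNReal.ofReal_div_of_pos (by positivity), ENNReal.ofReal_natCast,
      ENNReal.ofReal_pow (by norm_num), ← ENNReal.inv_pow, ENNReal.div_eq_inv_mul, mul_comm]
    simp
  rw [weight_eq_tsum, tsum_congr h]
  refine ⟨fun h => h.tsum_ofReal_ne_top, fun h => (ENNReal.summable_toReal h).congr fun n => ?_⟩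
  rw [ENNReal.toReal_ofReal (by positivity)]

theorem IsSummableSlalom.weight_ne_top {S : Set (ℕ × ℕ)} (hS : IsSummableSlalom S) :
    weight S ≠ ⊤ := (summable_iff_weight_ne_top hS.1.finite_sec).1 hS.2.2

theorem exists_weight_tail_lt {S : Set (ℕ × ℕ)} (hS : weight S ≠ ⊤) {ε : ENNReal} (hε : 0 < ε)
    (n : ℕ) : ∃ m ≥ n, weight (tail S m) < ε := by
  have h := tendsto_measure_iInter_atTop (μ := weight) (s := tail S)
    (fun _ => MeasurableSet.of_discrete.nullMeasurableSet)
    (fun m n hmn p hp => ⟨hp.1, hmn.trans hp.2⟩)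
    ⟨0, ne_top_of_le_ne_top hS (measure_mono (tail_subset S 0))⟩
  rw [show ⋂ m, tail S m = ∅ from eq_empty_of_forall_notMem fun p hp =>
    (mem_iInter.1 hp (p.1 + 1)).2.not_gt (Nat.lt_succ_self p.1), measure_empty] at h
  obtain ⟨m, hm, hm'⟩ := ((h.eventually_lt_const hε).and (Filter.eventually_ge_atTop n)).exists
  exact ⟨m, hm', hm⟩

theorem finite_sec_of_bounded {C : Set (ℕ × ℕ)} (hC : ∀ p ∈ C, p.2 < 2 ^ p.1) (n : ℕ) :
    (sec C n).Finite := (finite_Iio (2 ^ n)).subset fun _ hm => hC _ hm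

/-- Every set of finite weight below the exponential function is almost contained in a summable
slalom. -/
theorem exists_isSummableSlalom {C : Set (ℕ × ℕ)} (hC : ∀ p ∈ C, p.2 < 2 ^ p.1)
    (hw : weight C ≠ ⊤) : ∃ D, IsSummableSlalom D ∧ AlmostSubset C D := by
  -- When the tail has weight below `1`, so does each term `|C(n)| / 2 ^ n`, which is the slalom
  -- condition.
  obtain ⟨m, -, hm⟩ := exists_weight_tail_lt hw one_pos 0
  have hD : IsSlalom (tail C m) := by
    intro n
    have h : ((sec (tail C m) n).encard : ENNReal) * (2⁻¹ : ENNReal) ^ n < 1 := by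
      rw [weight_eq_tsum] at hm
      exact (ENNReal.le_tsum n).trans_lt hm
    rw [← ENNReal.inv_pow, ← div_eq_mul_inv, ENNReal.div_lt_iff (by simp) (by simp), one_mul] at h
    have h' : ((sec (tail C m) n).encard : ENNReal) < ((2 ^ n : ℕ) : ℕ∞) := by simpa using h
    exact_mod_cast h'
  refine ⟨tail C m, ⟨hD, fun n j hj => hC _ hj.1, ?_⟩, ?_⟩
  · exact (summable_iff_weight_ne_top hD.finite_sec).2
      (ne_top_of_le_ne_top hw (measure_mono (tail_subset C m)))
  · exact almostSubset_tail (finite_sec_of_bounded hC) m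

/-- Countably many bounded sets of finite weight are almost contained in one summable slalom. -/
theorem exists_pseudoUnion {ι : Type*} [Countable ι] {B : ι → Set (ℕ × ℕ)}
    (hB : ∀ i, ∀ p ∈ B i, p.2 < 2 ^ p.1) (hw : ∀ i, weight (B i) ≠ ⊤) :
    ∃ C, IsSummableSlalom C ∧ ∀ i, AlmostSubset (B i) C := by
  -- Tails of weight below `ε i`, with the `ε i` summing to less than `1`, have a union of finite
  -- weight.
  obtain ⟨ε, hε, hsum⟩ := ENNReal.exists_pos_sum_of_countable' one_ne_zero ι
  choose m _ hm using fun i => exists_weight_tail_lt (hw i) (hε i) 0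
  have hU : weight (⋃ i, tail (B i) (m i)) ≠ ⊤ := ne_top_of_le_ne_top (hsum.trans ENNReal.one_lt_top).ne <|
    (measure_iUnion_le _).trans (ENNReal.tsum_le_tsum fun i => (hm i).le)
  obtain ⟨C, hC, hUC⟩ := exists_isSummableSlalom
    (fun p hp => (mem_iUnion.1 hp).elim fun i hi => hB i p hi.1) hU
  exact ⟨C, hC, fun i => (almostSubset_tail (finite_sec_of_bounded (hB i)) (m i)).trans
    (AlmostSubset.trans (.of_subset (subset_iUnion (fun i => tail (B i) (m i)) i)) hUC)⟩

/-! ### Points of the space -/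

section Tower

open BooleanSubalgebra StoneSpace

variable {ι : Type*} {A : ι → Set (ℕ × ℕ)}

/-- The branch of a point. -/
def branchOf (x : TowerSpace A) : Set (ℕ × ℕ) :=
  {p | x ∈ basic (toModFin (containing_mem_treeAlg p))}

theorem branchOf_stonePoint {u : Ultrafilter Node} (hu : (u : Filter Node) ≤ Filter.cofinite) :
    branchOf (stonePoint (towerAlg A) u hu) = branch u :=
  Set.ext fun _ => toModFin_mem_stonePoint hu _

theorem isSlalom_branchOf (x : TowerSpace A) : IsSlalom (branchOf x) := by
  obtain ⟨u, hu, rfl⟩ := exists_stonePoint_eq x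
  rw [branchOf_stonePoint]
  exact isSlalom_branch

/-- The point of the space given by the canonical ultrafilter on a branch. -/
noncomputable def IsSlalom.point {B : Set (ℕ × ℕ)} (hB : IsSlalom B) : TowerSpace A :=
  stonePoint _ _ hB.ultrafilter_le

theorem IsSlalom.toModFin_mem_point {B : Set (ℕ × ℕ)} (hB : IsSlalom B) {a : Set Node}
    (ha : a ∈ towerAlg A) : toModFin ha ∈ (hB.point : TowerSpace A).1 ↔ a ∈ hB.ultrafilter :=
  toModFin_mem_stonePoint _ _

/-- The members `E` of the family with `above E` in the ultrafilter `x`. -/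
def traceOf (x : TowerSpace A) : Set (Set (ℕ × ℕ)) :=
  {E | ∃ hE : E ∈ finiteModClosure A, x ∈ basic (toModFin (above_mem_treeAlg hE))}

theorem mem_traceOf_stonePoint {u : Ultrafilter Node} (hu : (u : Filter Node) ≤ Filter.cofinite)
    {E : Set (ℕ × ℕ)} :
    E ∈ traceOf (stonePoint (towerAlg A) u hu) ↔ E ∈ finiteModClosure A ∧ above E ∈ u :=
  ⟨fun ⟨hE, h⟩ => ⟨hE, (toModFin_mem_stonePoint hu _).1 h⟩,
    fun ⟨hE, h⟩ => ⟨hE, (toModFin_mem_stonePoint hu (above_mem_treeAlg hE)).2 h⟩⟩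

theorem subset_branchOf {x : TowerSpace A} {E : Set (ℕ × ℕ)} (hE : E ∈ traceOf x) :
    E ⊆ branchOf x := by
  obtain ⟨u, hu, rfl⟩ := exists_stonePoint_eq x
  rw [branchOf_stonePoint]
  exact subset_branch hu ((mem_traceOf_stonePoint hu).1 hE).2

theorem mem_traceOf_of_almostSubset {x : TowerSpace A} {E E' : Set (ℕ × ℕ)}
    (hE' : E' ∈ traceOf x) (hE : E ∈ finiteModClosure A) (h : AlmostSubset E E')
    (hEB : E ⊆ branchOf x) : E ∈ traceOf x := by
  obtain ⟨u, hu, rfl⟩ := exists_stonePoint_eq x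
  rw [branchOf_stonePoint] at hEB
  rw [mem_traceOf_stonePoint hu] at hE' ⊢
  exact ⟨hE, above_mem_of_almostSubset hE'.2 h hEB⟩

/-- The branch decides the cones, the trace decides the sets `above E`, and these generate the
algebra. -/
theorem ext_of_branchOf_traceOf {x y : TowerSpace A} (hB : branchOf x = branchOf y)
    (hT : traceOf x = traceOf y) : x = y := by
  obtain ⟨u, hu, rfl⟩ := exists_stonePoint_eq x
  obtain ⟨v, hv, rfl⟩ := exists_stonePoint_eq y
  rw [branchOf_stonePoint, branchOf_stonePoint] at hB
  have key : ∀ a ∈ towerAlg A, (a ∈ u ↔ a ∈ v) := by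
    intro a ha
    induction ha using BooleanSubalgebra.closure_bot_sup_induction with
    | mem a ha =>
      rcases ha with ⟨E, hE, rfl⟩ | ⟨q, rfl⟩
      · have := Set.ext_iff.1 hT E
        rw [mem_traceOf_stonePoint hu, mem_traceOf_stonePoint hv] at this
        tauto
      · rw [cone_mem_iff hu, cone_mem_iff hv, hB]
    | bot => exact iff_of_false u.empty_notMem v.empty_notMem
    | sup a _ b _ iha ihb =>
      have h := or_congr iha ihb
      rwa [← Ultrafilter.union_mem_iff, ← Ultrafilter.union_mem_iff] at h
    | compl a _ ih => rw [Ultrafilter.compl_mem_iff_notMem, Ultrafilter.compl_mem_iff_notMem, ih]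
  refine Subtype.ext (Set.ext fun b => ?_)
  obtain ⟨a, ha, rfl⟩ := exists_eq_toModFin b
  rw [toModFin_mem_stonePoint, toModFin_mem_stonePoint, key a ha]

theorem isGrowthOfOmega_towerSpace : IsGrowthOfOmega (TowerSpace A) :=
  isGrowthOfOmega singleton_mem_treeAlg

namespace IsTower

variable [LinearOrder ι] (hA : IsTower A)
include hA

/-- For each point `x` of a countable dense set let `A (δ x)` escape its branch. A bound `C` of
these sets is escaped by some `A α`, so `α` is above all `δ x`; but the open set of `above (A α)`
contains one of the points, whose branch then contains `A α`. -/
theorem not_separableSpace : ¬ TopologicalSpace.SeparableSpace (TowerSpace A) := by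
  intro _
  obtain ⟨s, hs, hd⟩ := TopologicalSpace.exists_countable_dense (TowerSpace A)
  have _ : Countable s := hs
  choose δ hδ using fun x : s => hA.unbounded _ (isSlalom_branchOf x.1)
  obtain ⟨C, hC, hδC⟩ := exists_pseudoUnion (B := fun x : s => A (δ x))
    (fun x p hp => (hA.mem _).2.1 p.1 hp) fun x => (hA.mem _).weight_ne_top
  obtain ⟨α, hα⟩ := hA.unbounded C hC.1
  have hmem : A α ∈ finiteModClosure A := ⟨hA.isSlalom α, α, by simp [AlmostEq]⟩
  obtain ⟨x, hx, hxs⟩ := hd.inter_open_nonempty _ (isOpen_basic (toModFin (above_mem_treeAlg hmem)))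
    ⟨(hA.isSlalom α).point, ((hA.isSlalom α).toModFin_mem_point _).2
      ((hA.isSlalom α).above_mem_ultrafilter.2 Subset.rfl)⟩
  refine hδ ⟨x, hxs⟩ (AlmostSubset.trans (hA.mono _ α (le_of_not_ge fun h => hα ?_))
    (.of_subset (subset_branchOf ⟨hmem, hx⟩)))
  exact (hA.mono _ _ h).trans (hδC ⟨x, hxs⟩)

end IsTower

/-! ### The measure -/

/-- The union of the node `q` with, at each level from that of `q` on, the complement in
`{0, …, 2 ^ i - 1}` of one point determined by `t`. -/
def randomSlalom (y : Node × ℝ) : Set (ℕ × ℕ) :=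
  y.1.1.1 ∪ {p | y.1.1.2 ≤ p.1 ∧ p.2 < 2 ^ p.1 ∧ p.2 ≠ ⌊2 ^ p.1 * y.2⌋₊ % 2 ^ p.1}

theorem isSlalom_randomSlalom (y : Node × ℝ) : IsSlalom (randomSlalom y) := by
  have h : IsSlalom {p : ℕ × ℕ | p.2 < 2 ^ p.1 ∧ p.2 ≠ ⌊2 ^ p.1 * y.2⌋₊ % 2 ^ p.1} := by
    intro i
    have hss : sec {p : ℕ × ℕ | p.2 < 2 ^ p.1 ∧ p.2 ≠ ⌊2 ^ p.1 * y.2⌋₊ % 2 ^ p.1} i ⊂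
        Iio (2 ^ i) := by
      refine ⟨fun j hj => hj.1, fun h => ?_⟩
      exact (h (show ⌊2 ^ i * y.2⌋₊ % 2 ^ i ∈ Iio (2 ^ i) from
        Nat.mod_lt _ (Nat.two_pow_pos i))).2 rfl
    have := (finite_Iio (2 ^ i)).subset hss.subset |>.encard_lt_encard hss
    rwa [show (Iio (2 ^ i) : Set ℕ) = Finset.Iio (2 ^ i) by simp, encard_coe_eq_coe_finsetCard,
      Nat.card_Iio] at this
  refine (y.1.isSlalom_union_tail h).mono (union_subset_union_right _ ?_)
  exact fun p hp => ⟨hp.2, hp.1⟩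

theorem randomSlalom_inter_box (y : Node × ℝ) : randomSlalom y ∩ box y.1.1.2 = y.1.1.1 := by
  refine Subset.antisymm (fun p hp => ?_) fun p hp => ⟨.inl hp, y.1.subset_box hp⟩
  exact hp.1.resolve_right fun h => h.1.not_gt hp.2.1

/-- All sets of nodes are measurable. -/
instance : MeasurableSpace Node := ⊤

instance : DiscreteMeasurableSpace Node := ⟨fun _ => trivial⟩

theorem measurableSet_mem_randomSlalom (p : ℕ × ℕ) :
    MeasurableSet {y : Node × ℝ | p ∈ randomSlalom y} := by
  have h₁ : MeasurableSet {y : Node × ℝ | p ∈ y.1.1.1} :=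
    measurable_fst (MeasurableSet.of_discrete (s := containing p))
  have h₂ : MeasurableSet {y : Node × ℝ | y.1.1.2 ≤ p.1} :=
    measurable_fst (MeasurableSet.of_discrete (s := {q : Node | q.1.2 ≤ p.1}))
  have h₃ : Measurable fun y : Node × ℝ => ⌊2 ^ p.1 * y.2⌋₊ :=
    Nat.measurable_floor.comp (measurable_snd.const_mul _)
  have h₄ : MeasurableSet {y : Node × ℝ | p.2 ≠ ⌊2 ^ p.1 * y.2⌋₊ % 2 ^ p.1} :=
    h₃ (MeasurableSet.of_discrete (s := {k : ℕ | p.2 ≠ k % 2 ^ p.1}))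
  exact h₁.union (h₂.inter ((MeasurableSet.const _).inter h₄))

/-- The ultrafilters rest on an arbitrary choice, but membership of a generator depends on the
random slalom alone, through countably many conditions on single points. -/
theorem measurableSet_preimage_basic (b : (towerAlg A).modFin) :
    MeasurableSet ((fun y => (isSlalom_randomSlalom y).point) ⁻¹' basic b) := by
  obtain ⟨a, ha, rfl⟩ := exists_eq_toModFin b
  have h : (fun y => ((isSlalom_randomSlalom y).point : TowerSpace A)) ⁻¹' basic (toModFin ha) =
      {y | a ∈ (isSlalom_randomSlalom y).ultrafilter} :=
    Set.ext fun y => (isSlalom_randomSlalom y).toModFin_mem_point ha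
  rw [h]
  clear h
  induction ha using BooleanSubalgebra.closure_bot_sup_induction with
  | mem a ha =>
    rcases ha with ⟨E, hE, rfl⟩ | ⟨q, rfl⟩
    · simp only [IsSlalom.above_mem_ultrafilter, subset_def, ofPred_forall]
      exact .iInter fun p => .iInter fun _ => measurableSet_mem_randomSlalom p
    · simp only [IsSlalom.cone_mem_ultrafilter, Set.ext_iff, mem_inter_iff, ofPred_forall]
      refine .iInter fun p => ?_
      exact ((measurableSet_mem_randomSlalom p).inter (.const _)).iff (.const _)
  | bot => simp
  | sup a _ b _ iha ihb =>
    convert! iha.union ihb using 1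
    ext y
    exact Ultrafilter.union_mem_iff
  | compl a _ ih =>
    convert! ih.compl using 1
    ext y
    exact Ultrafilter.compl_mem_iff_notMem

/-- On `[0,1)` the reduction modulo `2 ^ i` is vacuous, so the set lies in one dyadic interval. The
reduction is there to keep `randomSlalom` a slalom for every real parameter. -/
theorem volume_floor_eq_le (i j : ℕ) :
    volume {t ∈ Ico (0 : ℝ) 1 | j = ⌊2 ^ i * t⌋₊ % 2 ^ i} ≤ (2⁻¹ : ENNReal) ^ i := by
  have h : {t ∈ Ico (0 : ℝ) 1 | j = ⌊2 ^ i * t⌋₊ % 2 ^ i} ⊆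
      Ico ((j : ℝ) / 2 ^ i) ((j + 1) / 2 ^ i) := by
    rintro t ⟨⟨h0, h1⟩, hj⟩
    have hpos : (0 : ℝ) < 2 ^ i := by positivity
    have hlt : ⌊2 ^ i * t⌋₊ < 2 ^ i := (Nat.floor_lt (by positivity)).2 (by push_cast; nlinarith)
    rw [Nat.mod_eq_of_lt hlt, eq_comm, Nat.floor_eq_iff (by positivity)] at hj
    exact ⟨(div_le_iff₀' hpos).2 hj.1, (lt_div_iff₀' hpos).2 hj.2⟩
  refine (measure_mono h).trans ?_
  rw [Real.volume_Ico, ← sub_div, add_sub_cancel_left, one_div, ← inv_pow,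
    ENNReal.ofReal_pow (by norm_num), ENNReal.ofReal_inv_of_pos two_pos]
  simp

theorem IsTower.supportsMeasure [LinearOrder ι] (hA : IsTower A) :
    SupportsMeasure (TowerSpace A) := by
  -- Only null sets matter, so the infinite product measure is replaced by a finite one with the
  -- same null sets.
  refine StoneSpace.supportsMeasure ((Measure.count.prod volume : Measure (Node × ℝ)).toFinite)
    measurableSet_preimage_basic fun b ⟨x, hx⟩ => pos_iff_ne_zero.2 fun h0 => ?_
  obtain ⟨a, ha, rfl⟩ := exists_eq_toModFin b
  obtain ⟨u, hu, rfl⟩ := exists_stonePoint_eq x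
  obtain ⟨δ, hδ⟩ := hA.exists_piBase hu
  obtain ⟨q, hq⟩ := hδ a ha ((toModFin_mem_stonePoint hu ha).1 hx)
  obtain ⟨m, hqm, hm⟩ := exists_weight_tail_lt (hA.mem δ).weight_ne_top one_pos q.1.2
  have hS := q.isSlalom_union_tail (hA.isSlalom δ)
  -- The parameters whose removed points all miss the tail of `A δ`. The exceptional set has measure
  -- at most the weight of that tail, which is below `1`.
  let G : Set ℝ := Ico 0 1 \ ⋃ p : tail (A δ) m, {t ∈ Ico (0 : ℝ) 1 |
    p.1.2 = ⌊2 ^ p.1.1 * t⌋₊ % 2 ^ p.1.1}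
  have hG : volume G ≠ 0 := by
    intro hG
    have h₁ : volume (Ico (0 : ℝ) 1) ≤ weight (tail (A δ) m) := by
      refine (measure_mono_ae (ae_le_set.2 hG)).trans ?_
      refine (measure_iUnion_le _).trans ?_
      rw [weight_apply]
      exact ENNReal.tsum_le_tsum fun p => volume_floor_eq_le _ _
    rw [Real.volume_Ico] at h₁
    simp at h₁
    exact h₁.not_gt hm
  have hsub : {hS.node m} ×ˢ G ⊆
      (fun y => ((isSlalom_randomSlalom y).point : TowerSpace A)) ⁻¹' basic (toModFin ha) := by
    rintro ⟨r, t⟩ ⟨hr, ht, ht'⟩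
    obtain rfl : r = hS.node m := hr
    set y : Node × ℝ := (hS.node m, t)
    have hbox : randomSlalom y ∩ box m = (q.1.1 ∪ tail (A δ) q.1.2) ∩ box m :=
      randomSlalom_inter_box y
    refine ((isSlalom_randomSlalom y).toModFin_mem_point ha).2 (Filter.mem_of_superset ?_ hq)
    refine Filter.inter_mem ((isSlalom_randomSlalom y).cone_mem_ultrafilter.2 ?_)
      ((isSlalom_randomSlalom y).above_mem_ultrafilter.2 fun p hp => ?_)
    · rw [← inter_eq_right.2 (box_mono hqm), ← inter_assoc, hbox, inter_assoc,
        inter_eq_right.2 (box_mono hqm), q.union_tail_inter_box]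
    · by_cases hpm : p ∈ box m
      · have : p ∈ randomSlalom y ∩ box m := by rw [hbox]; exact ⟨hp, hpm⟩
        exact this.1
      · have hpδ : p ∈ tail (A δ) q.1.2 :=
          hp.resolve_left fun h => hpm (box_mono hqm (q.subset_box h))
        have hp2 : p.2 < 2 ^ p.1 := (hA.mem δ).2.1 p.1 hpδ.1
        have hmp : m ≤ p.1 := by
          by_contra! hlt
          exact hpm ⟨hlt, hp2.trans_le (Nat.pow_le_pow_right two_pos hlt.le)⟩
        refine .inr ⟨hmp, hp2, fun h => ht' (mem_iUnion.2 ⟨⟨p, hpδ.1, hmp⟩, ht, h⟩)⟩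
  have h₂ := absolutelyContinuous_toFinite _ h0
  have h₃ := measure_mono_null hsub h₂
  rw [Measure.prod_prod, Measure.count_singleton, one_mul] at h₃
  exact hG h₃

end Tower

end Slalom

/-! ### Fibers -/

/-- A compact topology in which the open rays of a linear order are open is its order topology. -/
theorem orderTopology_of_isOpen_rays {X : Type*} [t : TopologicalSpace X] [CompactSpace X]
    [LinearOrder X] (h₁ : ∀ a : X, IsOpen (Iio a)) (h₂ : ∀ a : X, IsOpen (Ioi a)) :
    OrderTopology X := by
  have hle : t ≤ Preorder.topology X := by
    refine le_generateFrom ?_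
    rintro _ ⟨a, rfl | rfl⟩
    exacts [h₂ a, h₁ a]
  refine ⟨le_antisymm hle ?_⟩
  have hT2 : @T2Space X (Preorder.topology X) := by
    let _ := Preorder.topology X
    have _ : OrderTopology X := ⟨rfl⟩
    infer_instance
  -- The identity from a compact topology to a coarser Hausdorff one is closed.
  have hclosed : @IsClosedMap X X t (Preorder.topology X) id :=
    @Continuous.isClosedMap X X t (Preorder.topology X) _ hT2 id (continuous_id_iff_le.2 hle)
  refine TopologicalSpace.le_def.2 fun s hs => ?_
  have := hclosed _ hs.isClosed_compl
  rw [image_id] at this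
  exact (@isOpen_compl_iff X sᶜ (Preorder.topology X)).2 this |> (compl_compl s ▸ ·)

/-- A scattered compact space does not map continuously onto the unit interval. -/
theorem IsScatteredSpace.not_surjective_unitInterval {F : Type} [TopologicalSpace F]
    [CompactSpace F] (hF : IsScatteredSpace F) {h : F → unitInterval} (hc : Continuous h) :
    ¬ Function.Surjective h := by
  intro hs
  -- Take a closed `E` minimal with full image. Dropping a relatively isolated point `x` leaves a
  -- closed set whose image is closed and contains the dense complement of `h x`, against
  -- minimality.
  obtain ⟨E, _, hE, hmin⟩ := exists_compact_surjective_zorn_subset hc hs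
  obtain ⟨x, hxE, U, hU, hUE⟩ := hF E (by
    rw [← image_nonempty (f := h), hE]
    exact univ_nonempty)
  let E₀ : Set E := (Subtype.val ⁻¹' U)ᶜ
  have hE₀ : IsClosed E₀ := (hU.preimage continuous_subtype_val).isClosed_compl
  have hxU : x ∈ U := (hUE.symm.subset rfl).1
  refine hmin E₀ (fun h => ?_) hE₀ (eq_univ_of_univ_subset ?_)
  · have : (⟨x, hxE⟩ : E) ∈ E₀ := by rw [h]; trivial
    exact this hxU
  · have hcl : IsClosed (E.domRestrict h '' E₀) :=
      (hE₀.isCompact.image (hc.comp continuous_subtype_val)).isClosed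
    rw [← (dense_compl_singleton (h x)).closure_eq]
    refine closure_minimal (fun s hs => ?_) hcl
    obtain ⟨y, hy, rfl⟩ : s ∈ h '' E := by rw [hE]; trivial
    refine ⟨⟨y, hy⟩, fun hyU => hs ?_, rfl⟩
    rw [(hUE.subset ⟨hyU, hy⟩ : y = x)]
    rfl

/-- If a compact space maps onto a cube of uncountable weight, then some fiber of every continuous
map into the Cantor cube maps onto the unit interval by a coordinate. -/
theorem exists_fiber_onto_unitInterval {K J : Type*} [TopologicalSpace K] [CompactSpace K]
    [Uncountable J] {g : K → J → unitInterval} (hg : Continuous g) (hs : Function.Surjective g)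
    {f : K → ℕ → Bool} (hf : Continuous f) :
    ∃ (b : ℕ → Bool) (j : J), ∀ t, ∃ x, f x = b ∧ g x j = t := by
  classical
  -- Pairs of a closed set and a nonempty open box, restricting finitely many coordinates, that is
  -- covered by the image of the closed set.
  let P : Set K × Set (J → unitInterval) → Prop := fun σ =>
    IsClosed σ.1 ∧ IsOpen σ.2 ∧ σ.2.Nonempty ∧ σ.2 ⊆ g '' σ.1 ∧
      ∃ (s : Finset J) (o : J → Set unitInterval), σ.2 = (s : Set J).pi o
  have step : ∀ (n : ℕ) (σ : {σ // P σ}), ∃ τ : {σ // P σ}, τ.1.1 ⊆ σ.1.1 ∧ τ.1.2 ⊆ σ.1.2 ∧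
      ∃ b, ∀ x ∈ τ.1.1, f x n = b := by
    rintro n ⟨⟨C, W⟩, hC, hW, hWne, hWC, hWb⟩
    have hcl : ∀ b, IsClosed (C ∩ {x | f x n = b}) := fun b =>
      hC.inter (isClosed_singleton.preimage ((continuous_apply n).comp hf))
    -- Either the half `f x n = false` still covers the box, or a smaller box misses its image and
    -- is therefore covered by the other half.
    by_cases h : W ⊆ g '' (C ∩ {x | f x n = false})
    · exact ⟨⟨(C ∩ {x | f x n = false}, W), hcl _, hW, hWne, h, hWb⟩,
        (inter_subset_left : C ∩ {x | f x n = false} ⊆ C), Subset.rfl, false, fun x hx => hx.2⟩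
    · obtain ⟨z, hzW, hz⟩ := not_subset.1 h
      have hopen : IsOpen (W \ g '' (C ∩ {x | f x n = false})) :=
        hW.sdiff ((hcl false).isCompact.image hg).isClosed
      obtain ⟨V, hV, hzV, hVW⟩ :=
        (isTopologicalBasis_pi fun _ : J => TopologicalSpace.isTopologicalBasis_opens
          ).exists_subset_of_mem_open
          (show z ∈ W \ g '' (C ∩ {x | f x n = false}) from ⟨hzW, hz⟩) hopen
      refine ⟨⟨(C ∩ {x | f x n = true}, V), hcl _, ?_, ⟨z, hzV⟩, fun w hw => ?_, ?_⟩,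
        inter_subset_left, fun w hw => (hVW hw).1, true, fun x hx => hx.2⟩
      · exact (isTopologicalBasis_pi fun _ : J =>
          TopologicalSpace.isTopologicalBasis_opens).isOpen hV
      · obtain ⟨x, hx, rfl⟩ := hWC (hVW hw).1
        refine ⟨x, ⟨hx, ?_⟩, rfl⟩
        by_contra hne
        exact (hVW hw).2 ⟨x, ⟨hx, by simpa using hne⟩, rfl⟩
      · obtain ⟨o, s, -, rfl⟩ := hV
        exact ⟨s, o, rfl⟩
  choose next hnext₁ hnext₂ bit hbit using step
  have hK : P (univ, univ) := ⟨isClosed_univ, isOpen_univ, ⟨fun _ => 0, trivial⟩,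
    by rw [image_univ, hs.range_eq], ∅, fun _ => univ, by simp⟩
  let σ : ℕ → {σ // P σ} := fun n => Nat.rec ⟨_, hK⟩ next n
  have hσ : ∀ n, σ (n + 1) = next n (σ n) := fun n => rfl
  choose s o hso using fun n => (σ n).2.2.2.2.2
  obtain ⟨z, hz⟩ := IsCompact.nonempty_iInter_of_sequence_nonempty_isCompact_isClosed
    (fun n => closure (σ n).1.2) (fun n => closure_mono (by rw [hσ]; exact hnext₂ n _))
    (fun n => (σ n).2.2.2.1.closure) isClosed_closure.isCompact fun n => isClosed_closure
  have hcount : (⋃ n, (s n : Set J)).Countable := countable_iUnion fun n => (s n).countable_toSet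
  -- All boxes together restrict countably many coordinates. Changing `z` at a free coordinate `j`
  -- stays in every closure, hence in every image `g '' (σ n).1.1`.
  obtain ⟨j, hj⟩ : ∃ j, j ∉ ⋃ n, (s n : Set J) := by
    by_contra! h
    exact not_countable_univ (hcount.mono fun j _ => h j)
  refine ⟨fun n => bit n (σ n), j, fun t => ?_⟩
  have hmem : ∀ n, Function.update z j t ∈ g '' (σ n).1.1 := by
    intro n
    have hcl : IsClosed (g '' (σ n).1.1) := ((σ n).2.1.isCompact.image hg).isClosed
    refine closure_minimal (σ n).2.2.2.2.1 hcl ?_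
    have hzn := mem_iInter.1 hz n
    rw [hso, closure_pi_set] at hzn ⊢
    intro i hi
    rw [Function.update_of_ne fun h => hj (mem_iUnion.2 ⟨n, by rw [← h]; exact hi⟩)]
    exact hzn i hi
  obtain ⟨x, hx⟩ := IsCompact.nonempty_iInter_of_sequence_nonempty_isCompact_isClosed
    (fun n => (σ n).1.1 ∩ g ⁻¹' {Function.update z j t})
    (fun n => inter_subset_inter_left _ (by rw [hσ]; exact hnext₁ n _))
    (fun n => (hmem n).elim fun x hx => ⟨x, hx⟩)
    ((σ 0).2.1.inter (isClosed_singleton.preimage hg)).isCompact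
    fun n => (σ n).2.1.inter (isClosed_singleton.preimage hg)
  rw [mem_iInter] at hx
  refine ⟨x, funext fun n => hbit n _ x (by rw [← hσ]; exact (hx (n + 1)).1), ?_⟩
  rw [show g x = Function.update z j t from (hx 0).2, Function.update_self]

/-! ### The branch map and its fibers -/

namespace Slalom

open BooleanSubalgebra StoneSpace

variable {ι : Type*} {A : ι → Set (ℕ × ℕ)}

/-- The characteristic function of the branch of a point. -/
noncomputable def branchMap (x : TowerSpace A) (p : ℕ × ℕ) : Bool :=
  (basic (toModFin (containing_mem_treeAlg p))).boolIndicator x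

theorem continuous_branchMap : Continuous (branchMap : TowerSpace A → ℕ × ℕ → Bool) :=
  continuous_pi fun _ => (continuous_boolIndicator_iff_isClopen _).2 (isClopen_basic _)

theorem branchOf_eq_of_branchMap_eq {x y : TowerSpace A} (h : branchMap x = branchMap y) :
    branchOf x = branchOf y :=
  Set.ext fun p => by
    have := congrFun h p
    simp only [branchMap, boolIndicator] at this
    by_cases hx : x ∈ basic (toModFin (containing_mem_treeAlg (𝒜 := finiteModClosure A) p)) <;>
      by_cases hy : y ∈ basic (toModFin (containing_mem_treeAlg (𝒜 := finiteModClosure A) p)) <;>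
      simp_all [branchOf]

namespace IsTower

variable [LinearOrder ι] (hA : IsTower A)
include hA

theorem traceOf_total {x y : TowerSpace A} (h : branchOf x = branchOf y) :
    traceOf x ⊆ traceOf y ∨ traceOf y ⊆ traceOf x := by
  by_contra! hne
  obtain ⟨E, hE, hE'⟩ := not_subset.1 hne.1
  obtain ⟨F, hF, hF'⟩ := not_subset.1 hne.2
  rcases hA.almostSubset_total hE.1 hF.1 with h' | h'
  · exact hE' (mem_traceOf_of_almostSubset hF hE.1 h' (h ▸ subset_branchOf hE))
  · exact hF' (mem_traceOf_of_almostSubset hE hF.1 h' (h ▸ subset_branchOf hF))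

/-- Order a fiber by inclusion of traces. Open rays are unions of clopen sets of the form `E ∈
traceOf x` or their complements, and compactness does the rest. -/
theorem isLinearlyFibered : IsLinearlyFibered (TowerSpace A) := by
  classical
  refine ⟨ℕ × ℕ → Bool, TopologicalSpace.metrizableSpaceMetric _, branchMap,
    continuous_branchMap, fun b => ?_⟩
  have hbr : ∀ x y : branchMap (A := A) ⁻¹' {b}, branchOf x.1 = branchOf y.1 := fun x y =>
    branchOf_eq_of_branchMap_eq (x.2.trans y.2.symm)
  have hinj : Function.Injective fun x : branchMap (A := A) ⁻¹' {b} => traceOf x.1 := fun x y h =>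
    Subtype.ext (ext_of_branchOf_traceOf (hbr x y) h)
  let L : LinearOrder (branchMap (A := A) ⁻¹' {b}) :=
    { PartialOrder.lift _ hinj with
      le_total := fun x y => hA.traceOf_total (hbr x y)
      toDecidableLE := Classical.decRel _ }
  have hlt : ∀ x y : branchMap (A := A) ⁻¹' {b},
      x < y ↔ ∃ E ∈ finiteModClosure A, E ∈ traceOf y.1 ∧ E ∉ traceOf x.1 := by
    intro x y
    rw [← not_le, show y ≤ x ↔ traceOf y.1 ⊆ traceOf x.1 from Iff.rfl, not_subset]
    exact ⟨fun ⟨E, h, h'⟩ => ⟨E, h.1, h, h'⟩, fun ⟨E, _, h, h'⟩ => ⟨E, h, h'⟩⟩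
  have hclopen : ∀ E ∈ finiteModClosure A,
      IsClopen {x : branchMap (A := A) ⁻¹' {b} | E ∈ traceOf x.1} := by
    intro E hE
    have : {x : branchMap (A := A) ⁻¹' {b} | E ∈ traceOf x.1} =
        Subtype.val ⁻¹' basic (toModFin (above_mem_treeAlg hE)) :=
      Set.ext fun x => ⟨fun ⟨_, h⟩ => h, fun h => ⟨hE, h⟩⟩
    rw [this]
    exact (isClopen_basic _).preimage continuous_subtype_val
  have hcpt : CompactSpace (branchMap (A := A) ⁻¹' {b}) :=
    isCompact_iff_compactSpace.1 (isClosed_singleton.preimage continuous_branchMap).isCompact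
  refine ⟨L, orderTopology_of_isOpen_rays (fun y => ?_) fun x => ?_⟩
  · rw [show Iio y = ⋃ E ∈ {E | E ∈ finiteModClosure A ∧ E ∈ traceOf y.1},
        {x : branchMap (A := A) ⁻¹' {b} | E ∈ traceOf x.1}ᶜ by
      ext x
      simp only [mem_Iio, hlt, mem_iUnion, mem_compl_iff, mem_ofPred_eq, exists_prop, and_assoc]]
    exact isOpen_biUnion fun E hE => (hclopen E hE.1).compl.isOpen
  · rw [show Ioi x = ⋃ E ∈ {E | E ∈ finiteModClosure A ∧ E ∉ traceOf x.1},
        {y : branchMap (A := A) ⁻¹' {b} | E ∈ traceOf y.1} by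
      ext y
      simp only [mem_Ioi, hlt, mem_iUnion, mem_ofPred_eq, exists_prop, and_assoc]
      exact exists_congr fun E => and_congr_right fun _ => and_comm]
    exact isOpen_biUnion fun E hE => (hclopen E hE.1).isOpen

/-- Let `α` be the least index for which some `E =* A α` separates two points of `s`. Any `F`
separating two points whose traces omit `E` has an index at least `α`, so `E ⊆* F`, and the trace
containing `F` contains `E`. Hence exactly one point of `s` omits `E`, and a clopen set isolates it.
If nothing separates points of `s`, then `s` is a singleton. -/
theorem isScatteredSpace_fiber [WellFoundedLT ι] (b : ℕ × ℕ → Bool) :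
    IsScatteredSpace (branchMap (A := A) ⁻¹' {b}) := by
  intro s ⟨x₀, hx₀⟩
  have hbr : ∀ x y : branchMap (A := A) ⁻¹' {b}, branchOf x.1 = branchOf y.1 := fun x y =>
    branchOf_eq_of_branchMap_eq (x.2.trans y.2.symm)
  let S : Set ι := {α | ∃ E ∈ finiteModClosure A, AlmostEq E (A α) ∧
    (∃ x ∈ s, E ∈ traceOf x.1) ∧ ∃ y ∈ s, E ∉ traceOf y.1}
  have hS : ∀ x ∈ s, ∀ y ∈ s, ∀ E ∈ traceOf x.1, E ∉ traceOf y.1 → ∃ α ∈ S, AlmostEq E (A α) :=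
    fun x hx y hy E hEx hEy => hEx.1.2.imp fun α hα =>
      ⟨⟨E, hEx.1, hα, ⟨x, hx, hEx⟩, y, hy, hEy⟩, hα⟩
  by_cases hne : S.Nonempty
  · obtain ⟨E, hE, hEα, ⟨x, hx, hEx⟩, y, hy, hEy⟩ := wellFounded_lt.min_mem S hne
    refine ⟨y, hy, Subtype.val ⁻¹' (basic (toModFin (above_mem_treeAlg hE)))ᶜ,
      (isClopen_basic _).compl.isOpen.preimage continuous_subtype_val, ?_⟩
    have hno : ∀ z ∈ s, E ∉ traceOf z.1 → ∀ w ∈ s, E ∉ traceOf w.1 →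
        traceOf z.1 ⊆ traceOf w.1 := by
      intro z hz hEz w hw hEw F hFz
      by_contra hFw
      obtain ⟨β, hβ, hFβ⟩ := hS z hz w hw F hFz hFw
      have hle := hA.mono _ _ (WellFounded.min_le wellFounded_lt hβ)
      exact hEz (mem_traceOf_of_almostSubset hFz hE ((hEα.le.trans hle).trans hFβ.ge)
        (hbr x z ▸ subset_branchOf hEx))
    refine Subset.antisymm (fun z hz => ?_) (singleton_subset_iff.2 ⟨fun h => hEy ⟨hE, h⟩, hy⟩)
    have hEz : E ∉ traceOf z.1 := fun h => hz.1 h.2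
    exact Subtype.ext (ext_of_branchOf_traceOf (hbr z y)
      ((hno z hz.2 hEz y hy hEy).antisymm (hno y hy hEy z hz.2 hEz)))
  · refine ⟨x₀, hx₀, univ, isOpen_univ, ?_⟩
    rw [univ_inter]
    have hsub : ∀ x ∈ s, ∀ y ∈ s, traceOf x.1 ⊆ traceOf y.1 := fun x hx y hy E hE => by
      by_contra hEy
      exact hne ((hS x hx y hy E hE hEy).imp fun _ h => h.1)
    exact Subset.antisymm (fun x hx => Subtype.ext (ext_of_branchOf_traceOf (hbr x x₀)
      ((hsub x hx x₀ hx₀).antisymm (hsub x₀ hx₀ x hx)))) (singleton_subset_iff.2 hx₀)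

theorem isScatteredlyFibered [WellFoundedLT ι] : IsScatteredlyFibered (TowerSpace A) :=
  ⟨ℕ × ℕ → Bool, TopologicalSpace.metrizableSpaceMetric _, branchMap, continuous_branchMap,
    hA.isScatteredSpace_fiber⟩

theorem not_mapsOntoCubeOmegaOne [WellFoundedLT ι] : ¬ MapsOntoCubeOmegaOne (TowerSpace A) := by
  rintro ⟨g, hg, hs⟩
  have _ : Uncountable (Ordinal.omega.{0} 1).ToType := by
    rw [← Cardinal.aleph0_lt_mk_iff, Cardinal.mk_toType, Ordinal.card_omega]
    exact Cardinal.aleph0_lt_aleph_one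
  have hf : Continuous fun (x : TowerSpace A) n => branchMap x (Denumerable.ofNat (ℕ × ℕ) n) :=
    continuous_pi fun n => (continuous_apply (Denumerable.ofNat (ℕ × ℕ) n)).comp
      continuous_branchMap
  obtain ⟨b, j, hb⟩ := exists_fiber_onto_unitInterval hg hs hf
  let b' : ℕ × ℕ → Bool := fun p => b (Encodable.encode p)
  have _ : CompactSpace (branchMap (A := A) ⁻¹' {b'}) :=
    isCompact_iff_compactSpace.1 (isClosed_singleton.preimage continuous_branchMap).isCompact
  refine (hA.isScatteredSpace_fiber b').not_surjective_unitInterval (h := fun x => g x.1 j)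
    ((continuous_apply j).comp (hg.comp continuous_subtype_val)) fun t => ?_
  obtain ⟨x, hx, hxt⟩ := hb t
  refine ⟨⟨x, funext fun p => ?_⟩, hxt⟩
  have h : branchMap x (Denumerable.ofNat (ℕ × ℕ) (Encodable.encode p)) = b' p :=
    congrFun hx (Encodable.encode p)
  rwa [Denumerable.ofNat_encode] at h

end IsTower

end Slalom

namespace Slalom

/-! ### Independent events on the line -/

/-- The union of the intervals `(k, k + 2⁻ⁿ)`, `k ∈ ℤ`, rescaled by `2⁻ᶜ`. -/
def gridSet (c n : ℕ) : Set ℝ := ⋃ k : ℤ, {t | (k : ℝ) < 2 ^ c * t ∧ 2 ^ c * t < k + (2 ^ n)⁻¹}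

theorem isOpen_gridSet (c n : ℕ) : IsOpen (gridSet c n) :=
  isOpen_iUnion fun _ => isOpen_Ioo.preimage (continuous_const_mul ((2 : ℝ) ^ c))

/-- The cell of index `i` of the grid of mesh `2⁻ᶜ`. -/
def cell (c i : ℕ) : Set ℝ := Ico ((i : ℝ) / 2 ^ c) ((i + 1) / 2 ^ c)

theorem mem_cell {c i : ℕ} {t : ℝ} : t ∈ cell c i ↔ (i : ℝ) ≤ 2 ^ c * t ∧ 2 ^ c * t < i + 1 := by
  have h : (0 : ℝ) < 2 ^ c := by positivity
  rw [cell, mem_Ico, div_le_iff₀' h, lt_div_iff₀' h]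

theorem volume_cell (c i : ℕ) : volume (cell c i) = (2⁻¹ : ENNReal) ^ c := by
  rw [cell, Real.volume_Ico, ← sub_div, add_sub_cancel_left, one_div, ← inv_pow,
    ENNReal.ofReal_pow (by norm_num), ENNReal.ofReal_inv_of_pos two_pos]
  simp

theorem volume_gridSet_le (c n : ℕ) :
    volume (gridSet c n ∩ Ico 0 1) ≤ (2⁻¹ : ENNReal) ^ n := by
  have h : gridSet c n ∩ Ico 0 1 ⊆ ⋃ i ∈ Finset.range (2 ^ c), cell (c + n) (i * 2 ^ n) := by
    rintro t ⟨ht, h0, h1⟩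
    obtain ⟨k, hk, hk'⟩ := mem_iUnion.1 ht
    have hc : (0 : ℝ) < 2 ^ c := by positivity
    have hn : (0 : ℝ) < 2 ^ n := by positivity
    have hn1 : ((2 : ℝ) ^ n)⁻¹ ≤ 1 := inv_le_one_of_one_le₀ (one_le_pow₀ one_le_two)
    have hk0 : 0 ≤ k := by
      have : (-1 : ℝ) < k := by nlinarith
      have : (-1 : ℤ) < k := by exact_mod_cast this
      omega
    lift k to ℕ using hk0
    rw [Int.cast_natCast] at hk hk'
    have hkc : k < 2 ^ c := by
      have : (k : ℝ) < 2 ^ c := by nlinarith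
      exact_mod_cast this
    refine mem_biUnion (Finset.mem_coe.2 (Finset.mem_range.2 hkc)) (mem_cell.2 ?_)
    push_cast
    rw [pow_add, mul_comm ((2 : ℝ) ^ c), mul_assoc, mul_comm (k : ℝ)]
    refine ⟨mul_le_mul_of_nonneg_left hk.le hn.le, ?_⟩
    calc 2 ^ n * (2 ^ c * t) < 2 ^ n * (k + (2 ^ n)⁻¹) := mul_lt_mul_of_pos_left hk' hn
      _ = 2 ^ n * k + 1 := by field_simp
  refine (measure_mono h).trans ((measure_biUnion_finset_le _ _).trans ?_)
  simp only [volume_cell, Finset.sum_const, Finset.card_range, nsmul_eq_mul]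
  rw [pow_add, ← mul_assoc]
  push_cast
  rw [← mul_pow, ENNReal.mul_inv_cancel (by simp) (by simp), one_pow, one_mul]

section Independence

variable (n : ℕ → ℕ)

/-- The binary digits used by the first `J` events. -/
def gridLevel (J : ℕ) : ℕ := ∑ j ∈ Finset.range J, n j

theorem gridLevel_succ (J : ℕ) : gridLevel n (J + 1) = gridLevel n J + n J :=
  Finset.sum_range_succ _ _

/-- The points of the unit interval avoiding those of the first `J` events that lie in `s` are
covered by few cells, up to a null set. -/
theorem exists_cells (s : Set ℕ) (J : ℕ) : ∃ (G : Finset ℕ) (Z : Set ℝ), volume Z = 0 ∧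
    {t ∈ Ico (0 : ℝ) 1 | ∀ j < J, j ∈ s → t ∉ gridSet (gridLevel n j) (n j)} ⊆
      (⋃ i ∈ G, cell (gridLevel n J) i) ∪ Z ∧
    (G.card : ℝ) ≤ 2 ^ gridLevel n J *
      Real.exp (-∑ j ∈ Finset.range J, s.indicator (fun j => ((2 : ℝ) ^ n j)⁻¹) j) := by
  classical
  induction J with
  | zero =>
    refine ⟨{0}, ∅, measure_empty, fun t ht => .inl ?_, by simp [gridLevel]⟩
    simpa [cell, gridLevel] using ht.1
  | succ J ih =>
    obtain ⟨G, Z, hZ, hsub, hcard⟩ := ih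
    set c := gridLevel n J
    have hc : (0 : ℝ) < 2 ^ c := by positivity
    have hn : (0 : ℝ) < 2 ^ n J := by positivity
    -- Indices of the subcells of a cell that survive event `J`: all of them, or all but the first,
    -- which the event fills up to its left endpoint.
    let R : Finset ℕ := if J ∈ s then (Finset.range (2 ^ n J)).erase 0 else Finset.range (2 ^ n J)
    have hR : (R.card : ℝ) ≤
        2 ^ n J * Real.exp (-s.indicator (fun j => ((2 : ℝ) ^ n j)⁻¹) J) := by
      by_cases hJ : J ∈ s
      · have h1 : R.card = 2 ^ n J - 1 := by
          simp [R, hJ, Finset.card_erase_of_mem]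
        rw [h1, indicator_of_mem hJ, Nat.cast_sub Nat.one_le_two_pow]
        have h2 := Real.add_one_le_exp (-((2 : ℝ) ^ n J)⁻¹)
        calc (((2 ^ n J : ℕ) : ℝ) - (1 : ℕ)) = 2 ^ n J * (-((2 : ℝ) ^ n J)⁻¹ + 1) := by
              push_cast
              field_simp
              ring
          _ ≤ _ := mul_le_mul_of_nonneg_left h2 hn.le
      · simp [R, hJ]
    -- The grid intervals are open, so they miss the left endpoints of the cells; the null set
    -- absorbs these.
    refine ⟨(G ×ˢ R).image fun p => p.1 * 2 ^ n J + p.2,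
      Z ∪ range fun i : ℕ => (i : ℝ) / 2 ^ c, ?_, ?_, ?_⟩
    · exact measure_union_null hZ ((countable_range _).measure_zero _)
    · rintro t ⟨ht, hts⟩
      rcases hsub ⟨ht, fun j hj => hts j (hj.trans (Nat.lt_succ_self J))⟩ with h | h
      swap
      · exact .inr (.inl h)
      obtain ⟨i, hi, hti⟩ := mem_iUnion₂.1 h
      rw [mem_cell] at hti
      set x := (2 : ℝ) ^ n J * (2 ^ c * t - i)
      have hx0 : 0 ≤ x := mul_nonneg hn.le (by linarith)
      have hxn : x < 2 ^ n J := by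
        have := mul_lt_mul_of_pos_left (show 2 ^ c * t - i < 1 by linarith) hn
        rwa [mul_one] at this
      have hr : ⌊x⌋₊ < 2 ^ n J := (Nat.floor_lt hx0).2 (by exact_mod_cast hxn)
      by_cases hbad : J ∈ s ∧ ⌊x⌋₊ = 0
      · have hx1 : x < 1 := Nat.floor_eq_zero.1 hbad.2
        have hnot := hts J (Nat.lt_succ_self J) hbad.1
        refine .inr (.inr ⟨i, ?_⟩)
        by_contra hne
        refine hnot (mem_iUnion.2 ⟨i, ?_, ?_⟩)
        · rw [Int.cast_natCast]
          refine lt_of_le_of_ne hti.1 fun h => hne ?_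
          change (i : ℝ) / 2 ^ c = t
          rw [h, mul_div_cancel_left₀ _ hc.ne']
        · rw [Int.cast_natCast]
          have : 2 ^ c * t - i < (2 ^ n J)⁻¹ := by
            rw [← one_div, lt_div_iff₀' hn]
            exact hx1
          linarith
      · refine .inl (mem_biUnion (x := i * 2 ^ n J + ⌊x⌋₊) ?_ ?_)
        · refine Finset.mem_coe.2 (Finset.mem_image.2 ⟨(i, ⌊x⌋₊), ?_, rfl⟩)
          refine Finset.mem_product.2 ⟨hi, ?_⟩
          by_cases hJ : J ∈ s
          · simp only [R, hJ, if_true, Finset.mem_erase, Finset.mem_range]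
            exact ⟨fun h => hbad ⟨hJ, h⟩, hr⟩
          · simp only [R, hJ, if_false, Finset.mem_range]
            exact hr
        · rw [mem_cell, gridLevel_succ, pow_add]
          have h1 := Nat.floor_le hx0
          have h2 := Nat.lt_floor_add_one x
          have h3 : x = 2 ^ c * 2 ^ n J * t - i * 2 ^ n J := by simp only [x]; ring
          push_cast
          constructor <;> linarith
    · calc ((((G ×ˢ R).image fun p => p.1 * 2 ^ n J + p.2).card : ℕ) : ℝ)
          ≤ ((G.card * R.card : ℕ) : ℝ) := by
            exact_mod_cast Finset.card_image_le.trans (Finset.card_product G R).le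
        _ ≤ _ := by
            push_cast
            refine (mul_le_mul hcard hR (Nat.cast_nonneg _) (by positivity)).trans_eq ?_
            rw [gridLevel_succ, pow_add, Finset.sum_range_succ, neg_add, Real.exp_add]
            ring

/-- If the events of a subfamily have infinite total measure, almost no point avoids all of
them. -/
theorem volume_avoid_eq_zero {s : Set ℕ}
    (hs : ¬ Summable (s.indicator fun j => ((2 : ℝ) ^ n j)⁻¹)) :
    volume {t ∈ Ico (0 : ℝ) 1 | ∀ j ∈ s, t ∉ gridSet (gridLevel n j) (n j)} = 0 := by
  have hnn : ∀ j, 0 ≤ s.indicator (fun j => ((2 : ℝ) ^ n j)⁻¹) j := fun j =>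
    indicator_nonneg (fun _ _ => by positivity) j
  -- The proportion of surviving cells is at most the exponential of minus a partial sum of a
  -- divergent series.
  have hlim := (ENNReal.continuous_ofReal.tendsto _).comp (Real.tendsto_exp_neg_atTop_nhds_zero.comp
    ((not_summable_iff_tendsto_nat_atTop_of_nonneg hnn).1 hs))
  rw [ENNReal.ofReal_zero] at hlim
  refine le_antisymm (ge_of_tendsto' hlim fun J => ?_) bot_le
  obtain ⟨G, Z, hZ, hsub, hcard⟩ := exists_cells n s J
  calc volume {t ∈ Ico (0 : ℝ) 1 | ∀ j ∈ s, t ∉ gridSet (gridLevel n j) (n j)}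
      ≤ volume ((⋃ i ∈ G, cell (gridLevel n J) i) ∪ Z) :=
        measure_mono (Subset.trans (fun t ht => mem_sep ht.1 fun j _ hj => ht.2 j hj) hsub)
    _ ≤ volume (⋃ i ∈ G, cell (gridLevel n J) i) + volume Z := measure_union_le _ _
    _ ≤ ∑ i ∈ G, volume (cell (gridLevel n J) i) := by
        rw [hZ, add_zero]
        exact measure_biUnion_finset_le _ _
    _ = ENNReal.ofReal (G.card * (2 ^ gridLevel n J)⁻¹) := by
        simp only [volume_cell, Finset.sum_const, nsmul_eq_mul]
        rw [ENNReal.ofReal_mul (Nat.cast_nonneg _), ENNReal.ofReal_natCast,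
          ENNReal.ofReal_inv_of_pos (by positivity), ENNReal.ofReal_pow (by norm_num),
          ENNReal.inv_pow]
        simp
    _ ≤ _ := by
        refine ENNReal.ofReal_le_ofReal ?_
        rw [← div_eq_mul_inv, div_le_iff₀' (by positivity)]
        exact hcard

end Independence

/-! ### The additivity of the ideal of null sets -/

theorem sUnion_mem_nullIdeal {F : Set (Set ℝ)} (hF : F ⊆ nullIdeal)
    (hc : Cardinal.mk F < idealAdd nullIdeal) : ⋃₀ F ∈ nullIdeal := by
  by_contra h
  exact hc.not_ge (csInf_le' ⟨F, hF, h, rfl⟩)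

theorem aleph0_lt_idealAdd_nullIdeal : Cardinal.aleph0 < idealAdd nullIdeal := by
  -- The infimum of an empty set of cardinals would be `0`, so a family with non-null union is
  -- needed: all singletons.
  have hne : {κ | ∃ F : Set (Set ℝ), F ⊆ nullIdeal ∧ ⋃₀ F ∉ nullIdeal ∧
      Cardinal.mk F = κ}.Nonempty := by
    refine ⟨_, range fun t : ℝ => {t}, ?_, ?_, rfl⟩
    · rintro _ ⟨t, rfl⟩
      exact Real.volume_singleton
    · rw [sUnion_range, iUnion_of_singleton]
      simp [nullIdeal]
  obtain ⟨F, hF, hU, hκ⟩ := csInf_mem hne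
  rw [idealAdd, ← hκ]
  by_contra! h
  exact hU ((measure_sUnion_null_iff (Cardinal.le_aleph0_iff_set_countable.1 h)).2 hF)

/-- Attach to the points `p` independent open events `E p` of measure `2⁻ⁿ`, with `n` the level of
`p`. By Borel–Cantelli each `A` in `𝒲` yields a null set of reals in infinitely many of its events.
The union of these null sets is null, so a compact set `K` of positive measure avoids it. Baire's
theorem on `K` puts `A` almost inside one of countably many sets `B U`, whose weights are finite by
independence. -/
theorem exists_isSummableSlalom_of_lt {F : Set (Set (ℕ × ℕ))} (hF : ∀ A ∈ F, IsSummableSlalom A)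
    (hc : Cardinal.mk F < idealAdd nullIdeal) :
    ∃ C, IsSummableSlalom C ∧ ∀ A ∈ F, AlmostSubset A C := by
  let n : ℕ → ℕ := fun j => (Denumerable.ofNat (ℕ × ℕ) j).1
  let E : ℕ × ℕ → Set ℝ := fun p => gridSet (gridLevel n (Encodable.encode p)) p.1
  have hEo : ∀ p, IsOpen (E p) := fun p => isOpen_gridSet _ _
  let N : Set (ℕ × ℕ) → Set ℝ := fun A => {t | ∃ᶠ p : A in Filter.cofinite, t ∈ E p ∩ Ico 0 1}
  have hN : ∀ A ∈ F, volume (N A) = 0 := by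
    intro A hA
    refine measure_mono_null (t := Filter.limsup (fun p : A => E p ∩ Ico 0 1) Filter.cofinite)
      (fun t ht => ?_) (measure_limsup_cofinite_eq_zero ?_)
    · exact Filter.mem_limsup_iff_frequently_mem.2 ht
    · refine ne_top_of_le_ne_top (hF A hA).weight_ne_top ?_
      rw [weight_apply]
      exact ENNReal.tsum_le_tsum fun p => volume_gridSet_le _ _
  have hZ : volume (⋃₀ (N '' F)) = 0 := by
    refine sUnion_mem_nullIdeal ?_ (Cardinal.mk_image_le.trans_lt hc)
    rintro _ ⟨A, hA, rfl⟩
    exact hN A hA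
  obtain ⟨K₀, hK₀, hK₀c, hK₀pos⟩ : ∃ K₀ ⊆ Ico (0 : ℝ) 1 \ toMeasurable volume (⋃₀ (N '' F)),
      IsCompact K₀ ∧ 0 < volume K₀ := by
    refine MeasurableSet.exists_lt_isCompact
      (measurableSet_Ico.diff (measurableSet_toMeasurable _ _)) ?_
    rw [measure_sdiff_null (by rw [measure_toMeasurable, hZ])]
    simp
  -- Passing to the support makes every nonempty relatively open part of `K` non-null.
  let μ : Measure ℝ := volume.restrict K₀
  let K : Set ℝ := μ.support
  have hKK₀ : K ⊆ K₀ := by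
    exact Measure.support_subset_of_isClosed hK₀c.isClosed
      (ae_restrict_mem hK₀c.measurableSet)
  have hKc : IsCompact K := hK₀c.of_isClosed_subset Measure.isClosed_support hKK₀
  have hKne : K.Nonempty := by
    refine Measure.nonempty_support fun h => hK₀pos.ne' ?_
    rwa [Measure.restrict_eq_zero] at h
  have hKU : ∀ U : Set ℝ, IsOpen U → (K ∩ U).Nonempty → 0 < volume (K ∩ U) := by
    rintro U hU ⟨t, ht, htU⟩
    have h₁ := (Measure.mem_support_iff_forall t).1 ht U (hU.mem_nhds htU)
    have h₂ : μ U ≤ μ (K ∩ U) + μ Kᶜ := (measure_mono fun x hx =>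
      (em (x ∈ K)).imp (fun h => ⟨h, hx⟩) id).trans (measure_union_le _ _)
    rw [show μ Kᶜ = 0 from Measure.measure_compl_support, add_zero] at h₂
    exact (h₁.trans_le h₂).trans_le (Measure.restrict_le_self _)
  let B : Set ℝ → Set (ℕ × ℕ) := fun U => {p | p.2 < 2 ^ p.1 ∧ K ∩ U ∩ E p = ∅}
  -- Were the weight infinite, almost no point of `[0,1)` would avoid all `E p` with `p ∈ B U`; yet
  -- the non-null set `K ∩ U` does.
  have hBw : ∀ U : Set ℝ, IsOpen U → (K ∩ U).Nonempty → weight (B U) ≠ ⊤ := by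
    intro U hU hne htop
    let s : Set ℕ := {j | Denumerable.ofNat (ℕ × ℕ) j ∈ B U}
    have hs : ¬ Summable (s.indicator fun j => ((2 : ℝ) ^ n j)⁻¹) := by
      intro hs
      refine hs.tsum_ofReal_ne_top ?_
      rw [← htop, weight_apply, tsum_subtype (B U) fun p : ℕ × ℕ => (2⁻¹ : ENNReal) ^ p.1,
        ← (Denumerable.eqv (ℕ × ℕ)).symm.tsum_eq]
      refine tsum_congr fun j => ?_
      change _ = (B U).indicator _ (Denumerable.ofNat (ℕ × ℕ) j)
      by_cases hj : j ∈ s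
      · rw [indicator_of_mem hj, indicator_of_mem (show Denumerable.ofNat (ℕ × ℕ) j ∈ B U from hj),
          ENNReal.ofReal_inv_of_pos (by positivity), ENNReal.ofReal_pow (by norm_num),
          ENNReal.inv_pow]
        simp [n]
      · rw [indicator_of_notMem hj,
          indicator_of_notMem (show Denumerable.ofNat (ℕ × ℕ) j ∉ B U from hj),
          ENNReal.ofReal_zero]
    refine (hKU U hU hne).ne' (measure_mono_null (fun t ht => ?_) (volume_avoid_eq_zero n hs))
    refine ⟨(hK₀ (hKK₀ ht.1)).1, fun j hj htj => ?_⟩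
    have : t ∈ K ∩ U ∩ E (Denumerable.ofNat (ℕ × ℕ) j) := ⟨ht, by
      simpa only [E, Denumerable.encode_ofNat] using htj⟩
    rw [hj.2] at this
    exact this
  let 𝒰 : Set (Set ℝ) := {U ∈ TopologicalSpace.countableBasis ℝ | (K ∩ U).Nonempty}
  have h𝒰 : Countable 𝒰 :=
    ((TopologicalSpace.countable_countableBasis ℝ).mono (sep_subset _ _)).to_subtype
  have hopen : ∀ U ∈ 𝒰, IsOpen U := fun U hU => TopologicalSpace.isOpen_of_mem_countableBasis hU.1
  obtain ⟨C, hC, hBC⟩ := exists_pseudoUnion (B := fun U : 𝒰 => B U) (fun U p hp => hp.1)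
    fun U => hBw U (hopen U U.2) U.2.2
  refine ⟨C, hC, fun A hA => ?_⟩
  suffices h : ∃ U ∈ 𝒰, AlmostSubset A (B U) by
    obtain ⟨U, hU, hAU⟩ := h
    exact hAU.trans (hBC ⟨U, hU⟩)
  -- Every point of `K` is in finitely many events of `A`, so these closed sets cover `K` and one of
  -- them has interior. On a basic `U` meeting `K` there, all events of `A` with code at least `k`
  -- miss `K ∩ U`.
  let T : ℕ → Set K := fun k => {t | ∀ p ∈ A, k ≤ Encodable.encode p → t.1 ∉ E p}
  have hTc : ∀ k, IsClosed (T k) := by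
    intro k
    simp only [T, ofPred_forall]
    exact isClosed_iInter fun p => isClosed_iInter fun _ => isClosed_iInter fun _ =>
      ((hEo p).preimage continuous_subtype_val).isClosed_compl
  have hTU : ⋃ k, T k = univ := by
    refine eq_univ_of_forall fun t => mem_iUnion.2 ?_
    have ht := hK₀ (hKK₀ t.2)
    have hfin : ¬ ∃ᶠ p : A in Filter.cofinite, t.1 ∈ E p ∩ Ico 0 1 := fun h =>
      ht.2 (subset_toMeasurable _ _ ⟨_, mem_image_of_mem N hA, h⟩)
    rw [Filter.not_frequently, Filter.eventually_cofinite] at hfin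
    obtain ⟨k, hk⟩ := (hfin.image fun p : A => Encodable.encode p.1).bddAbove
    refine ⟨k + 1, fun p hp hkp htp => ?_⟩
    have := hk (mem_image_of_mem (fun p : A => Encodable.encode p.1)
      (show (⟨p, hp⟩ : A) ∈ _ from not_not.2 ⟨htp, ht.1⟩))
    exact absurd this (not_le.2 hkp)
  have _ : CompactSpace K := isCompact_iff_compactSpace.1 hKc
  have _ : Nonempty K := hKne.to_subtype
  obtain ⟨k, t, ht⟩ := nonempty_interior_of_iUnion_of_closed hTc hTU
  obtain ⟨V, hV, hVT⟩ := isOpen_induced_iff.1 (isOpen_interior (s := T k))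
  obtain ⟨U, hU, htU, hUV⟩ := (TopologicalSpace.isBasis_countableBasis ℝ).exists_subset_of_mem_open
    (show t.1 ∈ V by rw [← hVT] at ht; exact ht) hV
  refine ⟨U, ⟨hU, t.1, t.2, htU⟩, ?_⟩
  refine ((finite_lt_nat k).preimage Encodable.encode_injective.injOn).subset fun p hp => ?_
  by_contra hk
  refine hp.2 ⟨(hF A hA).2.1 p.1 hp.1, eq_empty_of_forall_notMem fun x hx => ?_⟩
  have : (⟨x, hx.1.1⟩ : K) ∈ interior (T k) := by
    rw [← hVT]
    exact hUV hx.1.2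
  exact interior_subset this p hp.1 (not_lt.1 hk) hx.2

end Slalom

namespace Slalom

/-! ### Slaloms coded by reals -/

/-- The graph of `n ↦ ⌊4ⁿ t⌋ mod 2ⁿ`, `n ≥ 1`. -/
def digitGraph (t : ℝ) : Set (ℕ × ℕ) := {p | 1 ≤ p.1 ∧ (p.2 : ℤ) = ⌊4 ^ p.1 * t⌋ % 2 ^ p.1}

theorem isSummableSlalom_digitGraph (t : ℝ) : IsSummableSlalom (digitGraph t) := by
  have hle : ∀ n, (sec (digitGraph t) n).encard ≤ 1 := fun n =>
    encard_le_one_iff.2 fun a b ha hb => by exact_mod_cast ha.2.trans hb.2.symm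
  have hslalom : IsSlalom (digitGraph t) := by
    -- As `2 ^ 0 = 1`, the section of a slalom at `0` is empty; this is why the graph starts at
    -- level `1`.
    rintro (_ | n)
    · have : sec (digitGraph t) 0 = ∅ := eq_empty_of_forall_notMem fun m hm =>
        absurd hm.1 (by norm_num)
      simp [this]
    · refine (hle _).trans_lt ?_
      have : 1 < 2 ^ (n + 1) := Nat.one_lt_two_pow n.succ_ne_zero
      exact_mod_cast this
  refine ⟨hslalom, fun n m hm => ?_, ?_⟩
  · have h := Int.emod_lt_of_pos ⌊4 ^ n * t⌋ (show (0 : ℤ) < 2 ^ n by positivity)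
    rw [← hm.2] at h
    exact_mod_cast h
  · refine Summable.of_nonneg_of_le (fun n => by positivity) (fun n => ?_)
      (summable_geometric_of_lt_one (r := (2 : ℝ)⁻¹) (by norm_num) (by norm_num))
    rw [inv_pow, ← one_div]
    have h1 : ((sec (digitGraph t) n).ncard : ℝ) ≤ 1 := by
      have h := hle n
      rw [← (hslalom.finite_sec n).cast_ncard_eq] at h
      exact_mod_cast h
    gcongr

/-- At each level `n` the slalom misses some `v n < 2 ^ n`, and a generic `t` has `(n, v n)` in its
graph for infinitely many `n`. -/
theorem isMeagre_setOf_digitGraph {S : Set (ℕ × ℕ)} (hS : IsSlalom S) :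
    IsMeagre {t | AlmostSubset (digitGraph t) S} := by
  have hv : ∀ n, ∃ v < 2 ^ n, v ∉ sec S n := by
    intro n
    by_contra! h
    refine (hS n).not_ge ?_
    have := encard_le_encard (show (Finset.range (2 ^ n) : Set ℕ) ⊆ sec S n from
      fun v hv => h v (Finset.mem_range.1 hv))
    rwa [encard_coe_eq_coe_finsetCard, Finset.card_range] at this
  choose v hv hvS using hv
  let O : ℕ → Set ℝ := fun n => ⋃ i : ℤ,
    {t | ((i * 2 ^ n + v n : ℤ) : ℝ) < 4 ^ n * t ∧ 4 ^ n * t < (i * 2 ^ n + v n : ℤ) + 1}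
  have hO : ∀ n, IsOpen (O n) := fun n =>
    isOpen_iUnion fun _ => isOpen_Ioo.preimage (continuous_const_mul ((4 : ℝ) ^ n))
  have hOmem : ∀ n, 1 ≤ n → ∀ t ∈ O n, (n, v n) ∈ digitGraph t := by
    intro n hn t ht
    obtain ⟨i, hi, hi'⟩ := mem_iUnion.1 ht
    refine ⟨hn, ?_⟩
    change ((v n : ℕ) : ℤ) = ⌊4 ^ n * t⌋ % 2 ^ n
    rw [Int.floor_eq_iff.2 ⟨hi.le, hi'⟩, add_comm, Int.add_mul_emod_self_right,
      Int.emod_eq_of_lt (Int.natCast_nonneg _) (by exact_mod_cast hv n)]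
  -- Along an interval of length `2⁻ⁿ` the number `4 ^ n * t` runs through a length `2 ^ n`, so
  -- every residue modulo `2 ^ n` occurs; this is the reason for the factor `4 ^ n`.
  have hdense : ∀ k, Dense (⋃ n ∈ Ici k, O n) := by
    intro k
    refine Metric.dense_iff.2 fun t ε hε => ?_
    obtain ⟨m, hm⟩ := exists_pow_lt_of_lt_one hε (show (2⁻¹ : ℝ) < 1 by norm_num)
    set n := max k m
    have hn : ((2 : ℝ) ^ n)⁻¹ < ε := by
      rw [← inv_pow]
      exact (pow_le_pow_of_le_one (by norm_num) (by norm_num) (le_max_right k m)).trans_lt hm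
    have h2 : (0 : ℝ) < 2 ^ n := by positivity
    have h4 : (4 : ℝ) ^ n = 2 ^ n * 2 ^ n := by rw [← mul_pow]; norm_num
    have hvn : (v n : ℝ) + 1 ≤ 2 ^ n := by exact_mod_cast hv n
    set x : ℝ := 2 ^ n * t
    have hx1 := Int.floor_le x
    have hx2 := Int.lt_floor_add_one x
    have hv0 : (0 : ℝ) ≤ v n := Nat.cast_nonneg _
    let s : ℝ := (⌊x⌋ * 2 ^ n + v n + 1 / 2) / 4 ^ n
    have hs : 4 ^ n * s = ⌊x⌋ * 2 ^ n + v n + 1 / 2 := by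
      simp only [s]
      field_simp
    refine ⟨s, ?_, mem_biUnion (x := n) (le_max_left k m) (mem_iUnion.2 ⟨⌊x⌋, ?_, ?_⟩)⟩
    · rw [Metric.mem_ball, Real.dist_eq]
      refine lt_trans ?_ hn
      have hst : 2 ^ n * (2 ^ n * (s - t)) = (⌊x⌋ - x) * 2 ^ n + v n + 1 / 2 := by
        have : 2 ^ n * (2 ^ n * (s - t)) = 4 ^ n * s - 2 ^ n * x := by
          rw [h4]
          simp only [x]
          ring
        rw [this, hs]
        ring
      have hb : |2 ^ n * (s - t)| < 1 := by
        rw [abs_lt]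
        constructor <;> nlinarith
      rw [abs_mul, abs_of_pos h2] at hb
      rwa [← one_div, lt_div_iff₀' h2]
    · rw [hs]
      push_cast
      linarith
    · rw [hs]
      push_cast
      linarith
  -- The bound `k + 1` instead of `k` ensures `1 ≤ n`, where the graph lives.
  have hsub : {t | AlmostSubset (digitGraph t) S} ⊆ ⋃ k, (⋃ n ∈ Ici (k + 1), O n)ᶜ := by
    intro t ht
    obtain ⟨k, hk⟩ := exists_subset_box ht
    refine mem_iUnion.2 ⟨k, fun h => ?_⟩
    obtain ⟨n, hn, htn⟩ := mem_iUnion₂.1 h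
    have hn : k + 1 ≤ n := hn
    have h₁ := hk ⟨hOmem n (by omega) t htn, hvS n⟩
    have h₂ : n < k := h₁.1
    omega
  refine (isMeagre_iUnion fun k => ?_).mono hsub
  rw [IsMeagre, compl_compl]
  exact residual_of_dense_open (isOpen_biUnion fun n _ => hO n) (hdense _)

theorem exists_nonmeagre : ∃ X : Set ℝ, ¬ IsMeagre X ∧ Cardinal.mk X = idealNon meagerIdeal := by
  have hne : {κ | ∃ s : Set ℝ, s ∉ meagerIdeal ∧ Cardinal.mk s = κ}.Nonempty :=
    ⟨_, univ, not_isMeagre_of_isGδ_of_dense .univ dense_univ, rfl⟩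
  exact csInf_mem hne

/-! ### Existence of towers -/

/-- Enumerate a nonmeager set in type `κ` and let `A α` bound all earlier `A β` and the digit graph
of the `α`-th real. A slalom bounding the tower would almost cover all these graphs, making the set
meager. -/
theorem exists_isUnboundedChain (h : idealAdd nullIdeal = idealNon meagerIdeal) :
    ∃ A : Set.Iio (idealAdd nullIdeal).ord → Set (ℕ × ℕ),
      IsUnboundedChain (idealAdd nullIdeal) A := by
  set κ := idealAdd nullIdeal
  obtain ⟨X, hX, hXκ⟩ := exists_nonmeagre
  rw [← h] at hXκ
  obtain ⟨φ⟩ : Nonempty (Set.Iio κ.ord ≃ X) := by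
    rw [← Cardinal.lift_mk_eq', Cardinal.mk_Iio_ordinal, hXκ, Cardinal.card_ord]
    simp
  -- The bound is a total function, with value `∅` where the hypotheses fail, so the recursion need
  -- not carry proofs.
  have hbound : ∀ F : Set (Set (ℕ × ℕ)), ∃ C, (∀ A ∈ F, IsSummableSlalom A) → Cardinal.mk F < κ →
      IsSummableSlalom C ∧ ∀ A ∈ F, AlmostSubset A C := by
    intro F
    by_cases hF : (∀ A ∈ F, IsSummableSlalom A) ∧ Cardinal.mk F < κ
    · obtain ⟨C, hC⟩ := exists_isSummableSlalom_of_lt hF.1 hF.2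
      exact ⟨C, fun _ _ => hC⟩
    · exact ⟨∅, fun h₁ h₂ => absurd ⟨h₁, h₂⟩ hF⟩
  choose g hg using hbound
  let A : Set.Iio κ.ord → Set (ℕ × ℕ) := wellFounded_lt.fix fun α ih =>
    g (insert (digitGraph (φ α)) (range fun β : Set.Iio α => ih β.1 β.2))
  have hA : ∀ α, A α = g (insert (digitGraph (φ α)) (range fun β : Set.Iio α => A β.1)) :=
    fun α => wellFounded_lt.fix_eq _ α
  have hcard : ∀ α, Cardinal.mk
      (insert (digitGraph (φ α)) (range fun β : Set.Iio α => A β.1) : Set (Set (ℕ × ℕ))) < κ := by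
    intro α
    have hω : Cardinal.aleph0 < κ := aleph0_lt_idealAdd_nullIdeal
    refine Cardinal.mk_insert_le.trans_lt (Cardinal.add_lt_of_lt hω.le ?_
      (Cardinal.one_lt_aleph0.trans hω))
    rw [← Cardinal.lift_lt.{0, 1}]
    have h₁ : Cardinal.mk (Set.Iio α) ≤ Cardinal.mk (Set.Iio α.1) :=
      Cardinal.mk_le_of_injective (f := fun β : Set.Iio α => (⟨β.1.1, β.2⟩ : Set.Iio α.1))
        fun β γ h => Subtype.ext (Subtype.ext (congrArg (fun δ : Set.Iio α.1 => δ.1) h))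
    have h₂ := Cardinal.mk_range_le_lift (f := fun β : Set.Iio α => A β.1)
    rw [Cardinal.lift_id'.{0, 1}] at h₂
    refine (h₂.trans h₁).trans_lt ?_
    rw [Cardinal.mk_Iio_ordinal, Cardinal.lift_lt]
    exact Cardinal.lt_ord.1 α.2
  have hmem : ∀ α, IsSummableSlalom (A α) := by
    intro α
    induction α using WellFoundedLT.induction with
    | _ α ih =>
      rw [hA]
      refine (hg _ ?_ (hcard α)).1
      rintro _ (rfl | ⟨β, rfl⟩)
      exacts [isSummableSlalom_digitGraph _, ih β.1 β.2]
  have hall : ∀ α, ∀ B ∈ insert (digitGraph (φ α)) (range fun β : Set.Iio α => A β.1),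
      AlmostSubset B (A α) := by
    intro α
    rw [hA α]
    refine (hg _ ?_ (hcard α)).2
    rintro _ (rfl | ⟨β, rfl⟩)
    exacts [isSummableSlalom_digitGraph _, hmem β.1]
  refine ⟨A, hmem, fun α β hαβ => hall β _ (.inr ⟨⟨α, hαβ⟩, rfl⟩), fun S hS => ?_⟩
  by_contra! hbd
  refine hX ((isMeagre_setOf_digitGraph hS).mono fun t ht => ?_)
  have h₁ := hall (φ.symm ⟨t, ht⟩) _ (.inl rfl)
  rw [φ.apply_symm_apply] at h₁
  exact h₁.trans (hbd _)

end Slalom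

theorem mainTheorem1 (h : idealAdd nullIdeal = idealNon meagerIdeal) :
    (∃ A : Set.Iio (idealAdd nullIdeal).ord → Set (ℕ × ℕ),
      Slalom.IsUnboundedChain (idealAdd nullIdeal) A) ∧
    ∀ A : Set.Iio (idealAdd nullIdeal).ord → Set (ℕ × ℕ),
      Slalom.IsUnboundedChain (idealAdd nullIdeal) A →
        IsGrowthOfOmega (Slalom.KSpace (Slalom.finiteModClosure A)) ∧
        ¬ TopologicalSpace.SeparableSpace (Slalom.KSpace (Slalom.finiteModClosure A)) ∧
        SupportsMeasure (Slalom.KSpace (Slalom.finiteModClosure A)) ∧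
        HasCountablePiCharacter (Slalom.KSpace (Slalom.finiteModClosure A)) ∧
        IsScatteredlyFibered (Slalom.KSpace (Slalom.finiteModClosure A)) ∧
        IsLinearlyFibered (Slalom.KSpace (Slalom.finiteModClosure A)) ∧
        ¬ MapsOntoCubeOmegaOne (Slalom.KSpace (Slalom.finiteModClosure A)) := by
  refine ⟨Slalom.exists_isUnboundedChain h, fun A hA => ?_⟩
  have hT := hA.isTower
  exact ⟨Slalom.isGrowthOfOmega_towerSpace, hT.not_separableSpace, hT.supportsMeasure,
    hT.hasCountablePiCharacter, hT.isScatteredlyFibered, hT.isLinearlyFibered,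
    hT.not_mapsOntoCubeOmegaOne⟩
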